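/- Let $p$ be an odd prime and let $n \ge 4$ be an integer. Let $G$ be the group with presentation $$G=\Big\langle x_1,x_2,x_3,x_4 \;\Big|\; x_1^{p^n}=x_2^{p^4}=x_3^{p^4}=x_4^{p^2}=1,\ [x_1,x_2]=x_2^{p^2},\ [x_1,x_3]=x_2^{p^2},\ [x_1,x_4]=x_3^{p^2},\ [x_2,x_3]=x_1^{p^{n-2}},\ [x_2,x_4]=x_3^{p^2},\ [x_3,x_4]=x_2^{p^2}\Big\rangle .$$ Then $G$ has order $p^{n+10}$ and exponent $p^n$, its minimal number of generators is $4$, and it is nilpotent of class exactly $2$. Write $\gamma_2(G)$, $\operatorname{Z}(G)$ and $\Phi(G)$ for the commutator subgroup, the centre and the Frattini subgroup of $G$, and $<$ for proper inclusion of subgroups. 1. If $n=4$, then $\gamma_2(G)=\operatorname{Z}(G)<\Phi(G)$. 2. If $n\ge 5$, then $\gamma_2(G)<\operatorname{Z}(G)<\Phi(G)$. Every automorphism $\alpha$ of $G$ is central, that is, $g^{-1}\alpha(g)\in \operatorname{Z}(G)$ for all $g\in G$. The group $\operatorname{Aut}(G)$ is abelian and has order $p^{n+20}$. -/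

import Mathlib

open scoped commutatorElement

/-- The defining relators, in the free group on `x 0, x 1, x 2, x 3` (standing for
`x₁, x₂, x₃, x₄`), of the presentation with relations
`x₁^(p^n) = x₂^(p^4) = x₃^(p^4) = x₄^(p^2) = 1`, `[x₁,x₂] = x₂^(p^2)`, `[x₁,x₃] = x₂^(p^2)`,
`[x₁,x₄] = x₃^(p^2)`, `[x₂,x₃] = x₁^(p^(n-2))`, `[x₂,x₄] = x₃^(p^2)`, `[x₃,x₄] = x₂^(p^2)`.
A relation `u = v` is recorded as the relator `u * v⁻¹`. The exponent `n - 2` is only used for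
`n ≥ 4`. The commutator is `⁅a, b⁆ = a * b * a⁻¹ * b⁻¹`. -/
def jryRelators (p n : ℕ) : Set (FreeGroup (Fin 4)) :=
  let x : Fin 4 → FreeGroup (Fin 4) := FreeGroup.of
  {x 0 ^ p ^ n, x 1 ^ p ^ 4, x 2 ^ p ^ 4, x 3 ^ p ^ 2,
    ⁅x 0, x 1⁆ * (x 1 ^ p ^ 2)⁻¹,
    ⁅x 0, x 2⁆ * (x 1 ^ p ^ 2)⁻¹,
    ⁅x 0, x 3⁆ * (x 2 ^ p ^ 2)⁻¹,
    ⁅x 1, x 2⁆ * (x 0 ^ p ^ (n - 2))⁻¹,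
    ⁅x 1, x 3⁆ * (x 2 ^ p ^ 2)⁻¹,
    ⁅x 2, x 3⁆ * (x 1 ^ p ^ 2)⁻¹}

/-- The group `G = G(p, n)` given by the four generators and the relators above. -/
abbrev JRYGroup (p n : ℕ) : Type := PresentedGroup (jryRelators p n)

/-! ### Commutator calculus. -/

section Commutators

variable {H : Type*} [Group H]

/-! Write `n = m + 4`. The relations force `x₁^(p^(n-2))`, `x₂^(p^2)`, `x₃^(p^2)` to be central, so
every element is a word `x₄^l x₃^k x₂^j x₁^i` (`exists_normal_form`). These words are distinct
modulo the orders in the presentation: `JRYModel`, a product of four cyclic groups twisted by a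
bilinear cocycle depending only on coordinates modulo `p^2`, satisfies the relations, and `toModel`
is an isomorphism. In coordinates, the centre consists of the elements vanishing modulo `p^2`, and
the commutator subgroup of the central elements whose first coordinate is killed by `p^2`.

The crux is `red_eq_of_jryRel`: for a generating tuple satisfying the relations, the commutator
relations become polynomial equations over `ZMod (p ^ 2)` whose only solution is the standard one.
Hence every automorphism is central, so it fixes commutators. Since `x₂^(p^2)`, `x₃^(p^2)`,
`x₄^(p^2)` lie in `γ₂`, the displacements of `x₂, x₃, x₄` lie in `γ₂`; conversely any displacements
in `Z × γ₂ × γ₂ × γ₂` occur (`exists_aut`). Thus `|Aut G| = |Z| |γ₂|^3 = p^(n+2) p^18`. -/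

theorem mul_eq_of_commutator_eq {x y z : H} (h : ⁅x, y⁆ = z) : x * y = z * (y * x) := by
  rw [← h, commutatorElement_def]; group

/-- Conjugation by `y` sends `x` to `z⁻¹ * x`. Only `x` has to commute with `z`, so the lemma
applies before `z` is known to be central. -/
theorem commutator_zpow_left {x y z : H} (h : ⁅x, y⁆ = z) (hz : Commute x z) (k : ℤ) :
    ⁅x ^ k, y⁆ = z ^ k := by
  have h1 : y * x * y⁻¹ = z⁻¹ * x := by rw [← h, commutatorElement_def]; group
  have h2 : y * x ^ k * y⁻¹ = z⁻¹ ^ k * x ^ k := by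
    rw [← conj_zpow, h1, (hz.symm.inv_left).mul_zpow]
  have h3 : ⁅x ^ k, y⁆ = x ^ k * (y * x ^ k * y⁻¹)⁻¹ := by rw [commutatorElement_def]; group
  rw [h3, h2, mul_inv_rev, inv_zpow, inv_inv, mul_inv_cancel_left]

theorem commutator_zpow_right {x y z : H} (h : ⁅x, y⁆ = z) (hz : Commute y z) (k : ℤ) :
    ⁅x, y ^ k⁆ = z ^ k := by
  have h' : ⁅y, x⁆ = z⁻¹ := by rw [← h, commutatorElement_inv]
  rw [← commutatorElement_inv, commutator_zpow_left h' hz.inv_right, inv_zpow, inv_inv]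

theorem commute_pow_left {x y z : H} (h : ⁅x, y⁆ = z) (hz : Commute x z) {k : ℕ}
    (hk : z ^ k = 1) : Commute (x ^ k) y := by
  rw [← commutatorElement_eq_one_iff_commute]
  have := commutator_zpow_left h hz k
  simpa [hk] using this

theorem commute_pow_right {x y z : H} (h : ⁅x, y⁆ = z) (hz : Commute y z) {k : ℕ}
    (hk : z ^ k = 1) : Commute x (y ^ k) := by
  rw [← commutatorElement_eq_one_iff_commute]
  have := commutator_zpow_right h hz k
  simpa [hk] using this

theorem zpow_mul_zpow_of_commutator {x y z : H} (h : ⁅x, y⁆ = z) (hx : Commute x z)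
    (hy : Commute y z) (i j : ℤ) : x ^ i * y ^ j = z ^ (i * j) * (y ^ j * x ^ i) := by
  apply mul_eq_of_commutator_eq
  rw [zpow_mul]
  exact commutator_zpow_right (commutator_zpow_left h hx i) (hy.zpow_right i) j

end Commutators

/-! ### Consequences of the relations and the normal form. -/

/-- The tuple `y` satisfies the defining relations of `JRYGroup p n`. -/
structure JRYRel (p n : ℕ) {H : Type*} [Group H] (y : Fin 4 → H) : Prop where
  pow0 : y 0 ^ p ^ n = 1
  pow1 : y 1 ^ p ^ 4 = 1
  pow2 : y 2 ^ p ^ 4 = 1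
  pow3 : y 3 ^ p ^ 2 = 1
  comm01 : ⁅y 0, y 1⁆ = y 1 ^ p ^ 2
  comm02 : ⁅y 0, y 2⁆ = y 1 ^ p ^ 2
  comm03 : ⁅y 0, y 3⁆ = y 2 ^ p ^ 2
  comm12 : ⁅y 1, y 2⁆ = y 0 ^ p ^ (n - 2)
  comm13 : ⁅y 1, y 3⁆ = y 2 ^ p ^ 2
  comm23 : ⁅y 2, y 3⁆ = y 1 ^ p ^ 2

theorem jryRel_iff {p n : ℕ} {H : Type*} [Group H] (y : Fin 4 → H) :
    JRYRel p n y ↔ ∀ r ∈ jryRelators p n, FreeGroup.lift y r = 1 := by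
  simp only [jryRelators, Set.mem_insert_iff, Set.mem_singleton_iff, forall_eq_or_imp, forall_eq,
    map_mul, map_inv, map_pow, map_commutatorElement, FreeGroup.lift_apply_of, mul_inv_eq_one]
  exact ⟨fun ⟨a, b, c, d, e, f, g, h, i, j⟩ => ⟨a, b, c, d, e, f, g, h, i, j⟩,
    fun ⟨a, b, c, d, e, f, g, h, i, j⟩ => ⟨a, b, c, d, e, f, g, h, i, j⟩⟩

namespace JRYRel

variable {p n : ℕ} {H : Type*} [Group H] {y : Fin 4 → H}

theorem map {K : Type*} [Group K] (R : JRYRel p n y) (f : H →* K) :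
    JRYRel p n (fun i => f (y i)) := by
  rw [jryRel_iff] at R ⊢
  intro r hr
  have : FreeGroup.lift (fun i => f (y i)) = f.comp (FreeGroup.lift y) := by
    ext i; simp
  rw [this, MonoidHom.comp_apply, R r hr, map_one]

/-- The powers `y₁^(p^(n-2))`, `y₂^(p^2)`, `y₃^(p^2)` commute with the four generators. -/
theorem commute_all (R : JRYRel p n y) (hn : 4 ≤ n) (i : Fin 4) :
    Commute (y i) (y 0 ^ p ^ (n - 2)) ∧ Commute (y i) (y 1 ^ p ^ 2) ∧
      Commute (y i) (y 2 ^ p ^ 2) := by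
  have hbp : ∀ k, 2 ≤ k → (y 1 ^ p ^ 2) ^ p ^ k = 1 := fun k hk => by
    obtain ⟨t, rfl⟩ := Nat.exists_eq_add_of_le hk
    rw [← pow_mul, show p ^ 2 * p ^ (2 + t) = p ^ 4 * p ^ t by ring, pow_mul, R.pow1, one_pow]
  have hcp : ∀ k, 2 ≤ k → (y 2 ^ p ^ 2) ^ p ^ k = 1 := fun k hk => by
    obtain ⟨t, rfl⟩ := Nat.exists_eq_add_of_le hk
    rw [← pow_mul, show p ^ 2 * p ^ (2 + t) = p ^ 4 * p ^ t by ring, pow_mul, R.pow2, one_pow]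
  have hap : (y 0 ^ p ^ (n - 2)) ^ p ^ 2 = 1 := by
    rw [← pow_mul, ← pow_add, Nat.sub_add_cancel (by omega), R.pow0]
  have hk : 2 ≤ n - 2 := by omega
  -- The starting point: conjugation by `y 0` raises `y 1` to the power `1 + p^2`, hence fixes `y 1
  -- ^ p ^ 2` because `y 1 ^ p ^ 4 = 1`.
  have b0 : Commute (y 0) (y 1 ^ p ^ 2) := by
    have h1 : y 0 * y 1 * (y 0)⁻¹ = y 1 ^ (p ^ 2 + 1) := by
      rw [pow_succ, ← R.comm01, commutatorElement_def]; group
    have h2 : y 0 * y 1 ^ p ^ 2 * (y 0)⁻¹ = y 1 ^ p ^ 2 := by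
      rw [← conj_pow, h1, ← pow_mul, add_mul, one_mul, pow_add, ← pow_add p 2 2, R.pow1, one_mul]
    exact mul_inv_eq_iff_eq_mul.mp h2
  have b1 : Commute (y 1) (y 1 ^ p ^ 2) := (Commute.refl _).pow_right _
  have c2 : Commute (y 2) (y 2 ^ p ^ 2) := (Commute.refl _).pow_right _
  have a0 : Commute (y 0) (y 0 ^ p ^ (n - 2)) := (Commute.refl _).pow_right _
  -- A bootstrap: each commutation just proved is the side condition that the power lemmas need for
  -- a later one.
  have a1 := commute_pow_left R.comm01 b0 (hbp _ hk)
  have a2 := commute_pow_left R.comm02 b0 (hbp _ hk)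
  have b2 := commute_pow_left R.comm12 a1.symm hap
  have c1 := commute_pow_right R.comm12 a2.symm hap
  have c0 := commute_pow_right R.comm02 b2.symm (hbp 2 le_rfl)
  have c3 := commute_pow_left R.comm23 b2.symm (hbp 2 le_rfl)
  have b3 := commute_pow_left R.comm13 c1 (hcp 2 le_rfl)
  have a3 := commute_pow_left R.comm03 c0 (hcp _ hk)
  fin_cases i
  exacts [⟨a0, b0, c0⟩, ⟨a1.symm, b1, c1⟩, ⟨a2.symm, b2.symm, c2⟩, ⟨a3.symm, b3.symm, c3.symm⟩]

theorem mem_center_of_commute (hy : Subgroup.closure (Set.range y) = ⊤) {z : H}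
    (hz : ∀ i, Commute (y i) z) : z ∈ Subgroup.center H := by
  have : Subgroup.closure (Set.range y) ≤ Subgroup.centralizer {z} := by
    rw [Subgroup.closure_le]
    rintro _ ⟨i, rfl⟩
    exact Subgroup.mem_centralizer_singleton_iff.mpr (hz i)
  rw [hy] at this
  exact Subgroup.mem_center_iff.mpr fun g =>
    Subgroup.mem_centralizer_singleton_iff.mp (this (Subgroup.mem_top g))

/-- The normal form: every element is `y₄^l y₃^k y₂^j y₁^i`. -/
theorem exists_normal_form (R : JRYRel p n y) (hn : 4 ≤ n)
    (hy : Subgroup.closure (Set.range y) = ⊤) (g : H) :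
    ∃ i j k l : ℤ, g = y 3 ^ l * (y 2 ^ k * (y 1 ^ j * y 0 ^ i)) := by
  have C := R.commute_all hn
  have hg : g ∈ Subgroup.closure (Set.range y) := hy ▸ Subgroup.mem_top g
  have e01 := zpow_mul_zpow_of_commutator R.comm01 (C 0).2.1 (C 1).2.1
  have e02 := zpow_mul_zpow_of_commutator R.comm02 (C 0).2.1 (C 2).2.1
  have e03 := zpow_mul_zpow_of_commutator R.comm03 (C 0).2.2 (C 3).2.2
  have e12 := zpow_mul_zpow_of_commutator R.comm12 (C 1).1 (C 2).1
  have e13 := zpow_mul_zpow_of_commutator R.comm13 (C 1).2.2 (C 3).2.2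
  have e23 := zpow_mul_zpow_of_commutator R.comm23 (C 2).2.1 (C 3).2.1
  -- The central powers become opaque letters, so that rewriting can move them as atoms.
  generalize ha : y 0 ^ p ^ (n - 2) = a at *
  generalize hb : y 1 ^ p ^ 2 = b at *
  generalize hc : y 2 ^ p ^ 2 = c at *
  have ha' : ∀ t : ℤ, a ^ t = y 0 ^ ((p ^ (n - 2) : ℕ) * t : ℤ) := fun t => by
    rw [← ha, zpow_mul, zpow_natCast]
  have hb' : ∀ t : ℤ, b ^ t = y 1 ^ ((p ^ 2 : ℕ) * t : ℤ) := fun t => by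
    rw [← hb, zpow_mul, zpow_natCast]
  have hc' : ∀ t : ℤ, c ^ t = y 2 ^ ((p ^ 2 : ℕ) * t : ℤ) := fun t => by
    rw [← hc, zpow_mul, zpow_natCast]
  have left : ∀ {z : H}, (∀ i, Commute (y i) z) → ∀ (g h : H) (t : ℤ),
      g * (z ^ t * h) = z ^ t * (g * h) := fun hz g h t => by
    have := Subgroup.mem_center_iff.mp
      (Subgroup.zpow_mem _ (mem_center_of_commute hy hz) t) g
    rw [← mul_assoc, this, mul_assoc]
  have A : ∀ (q : Fin 4) (s t : ℤ) (h : H), y q ^ s * (a ^ t * h) = a ^ t * (y q ^ s * h) :=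
    fun q s t h => left (fun q => (C q).1) _ _ _
  have B : ∀ (q : Fin 4) (s t : ℤ) (h : H), y q ^ s * (b ^ t * h) = b ^ t * (y q ^ s * h) :=
    fun q s t h => left (fun q => (C q).2.1) _ _ _
  have D : ∀ (q : Fin 4) (s t : ℤ) (h : H), y q ^ s * (c ^ t * h) = c ^ t * (y q ^ s * h) :=
    fun q s t h => left (fun q => (C q).2.2) _ _ _
  have DB : ∀ (s t : ℤ) (h : H), c ^ s * (b ^ t * h) = b ^ t * (c ^ s * h) :=
    fun s t h => left (fun q => (C q).2.1) _ _ _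
  have swap : ∀ {x y z : H}, x * y = z * (y * x) → ∀ h : H, x * (y * h) = z * (y * (x * h)) :=
    fun e h => by rw [← mul_assoc, e]; simp only [mul_assoc]
  -- closure of the set of normal forms under right multiplication by powers of the generators
  have key : ∀ (q : Fin 4) (t i j k l : ℤ), ∃ i' j' k' l' : ℤ,
      y 3 ^ l * (y 2 ^ k * (y 1 ^ j * y 0 ^ i)) * y q ^ t =
        y 3 ^ l' * (y 2 ^ k' * (y 1 ^ j' * y 0 ^ i')) := by
    intro q t i j k l
    fin_cases q
    · exact ⟨i + t, j, k, l, by simp only [zpow_add, mul_assoc, Fin.zero_eta]⟩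
    · refine ⟨i, j + (p ^ 2 : ℕ) * (i * t) + t, k, l, ?_⟩
      simp only [Fin.mk_one, mul_assoc, e01, zpow_add, ← hb']
    · refine ⟨(p ^ (n - 2) : ℕ) * (j * t) + i, j + (p ^ 2 : ℕ) * (i * t), k + t, l, ?_⟩
      simp only [Fin.reduceFinMk, mul_assoc, zpow_add, ← hb', ← ha', e02, swap (e12 _ _), A, B]
    -- Moving `x₄^t` to the left past `x₁^i`, `x₂^j`, `x₃^k` costs `c^(i*t)`, `c^(j*t)`, `b^(k*t)`.
    · refine ⟨i, j + (p ^ 2 : ℕ) * (k * t), k + (p ^ 2 : ℕ) * (i * t + j * t), l + t, ?_⟩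
      simp only [Fin.reduceFinMk, mul_assoc, zpow_add, mul_add, ← hb', ← hc', e03, swap (e13 _ _),
        swap (e23 _ _), B, D, DB]
  refine Subgroup.closure_induction_right (p := fun g _ => ∃ i j k l : ℤ,
    g = y 3 ^ l * (y 2 ^ k * (y 1 ^ j * y 0 ^ i))) ⟨0, 0, 0, 0, by simp⟩ ?_ ?_ hg
  · rintro x _ _ ⟨q, rfl⟩ ⟨i, j, k, l, rfl⟩
    simpa using key q 1 i j k l
  · rintro x _ _ ⟨q, rfl⟩ ⟨i, j, k, l, rfl⟩
    simpa using key q (-1) i j k l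

end JRYRel

/-! ### Arithmetic of `ZMod (p ^ (k + 2))` relative to `ZMod (p ^ 2)`. -/

section ZModPowers

/-- Multiplication by `p ^ k`, as an embedding of `ZMod (p ^ 2)` in `ZMod (p ^ (k + 2))`. -/
def scale (p k : ℕ) : ZMod (p ^ 2) →+ ZMod (p ^ (k + 2)) :=
  ZMod.lift (p ^ 2) ⟨(AddMonoidHom.mulLeft ((p : ZMod (p ^ (k + 2))) ^ k)).comp
    (Int.castAddHom _), by
      have : ((p ^ (k + 2) : ℕ) : ZMod (p ^ (k + 2))) = 0 := ZMod.natCast_self _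
      simpa [pow_add] using this⟩

/-- Reduction modulo `p ^ 2`. -/
def red (p k : ℕ) : ZMod (p ^ (k + 2)) →+* ZMod (p ^ 2) :=
  ZMod.castHom (pow_dvd_pow p (Nat.le_add_left 2 k)) _

variable {p k : ℕ}

theorem scale_intCast (x : ℤ) : scale p k (x : ZMod (p ^ 2)) = (p : ZMod (p ^ (k + 2))) ^ k * x := by
  simp [scale]

theorem scale_red (x : ZMod (p ^ (k + 2))) :
    scale p k (red p k x) = (p : ZMod (p ^ (k + 2))) ^ k * x := by
  obtain ⟨x, rfl⟩ := ZMod.intCast_surjective x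
  rw [map_intCast, scale_intCast]

theorem natCast_sq_eq_zero (p : ℕ) : (p : ZMod (p ^ 2)) ^ 2 = 0 := by
  exact_mod_cast ZMod.natCast_self (p ^ 2)

theorem red_sq_mul (x : ZMod (p ^ (k + 2))) :
    red p k ((p : ZMod (p ^ (k + 2))) ^ 2 * x) = 0 := by
  simp [natCast_sq_eq_zero]

/-- For `k ≥ 2` the factor `p^k` is a multiple of `p^2`. Thus the cocycle's values are invisible to
the reduced coordinates it is computed from, and the group axioms of the model reduce to
bilinearity. -/
theorem red_scale (hk : 2 ≤ k) (x : ZMod (p ^ 2)) : red p k (scale p k x) = 0 := by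
  obtain ⟨x, rfl⟩ := ZMod.intCast_surjective x
  obtain ⟨j, rfl⟩ := Nat.exists_eq_add_of_le hk
  rw [scale_intCast, pow_add (p : ZMod (p ^ (2 + j + 2))), mul_assoc, red_sq_mul]

theorem sq_mul_scale (x : ZMod (p ^ 2)) : (p : ZMod (p ^ (k + 2))) ^ 2 * scale p k x = 0 := by
  have h : (p : ZMod (p ^ (k + 2))) ^ (k + 2) = 0 := by
    exact_mod_cast ZMod.natCast_self (p ^ (k + 2))
  obtain ⟨x, rfl⟩ := ZMod.intCast_surjective x
  rw [scale_intCast, ← mul_assoc, ← pow_add, add_comm 2 k, h, zero_mul]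

theorem scale_injective (hp : 0 < p) : Function.Injective (scale p k) := by
  rw [injective_iff_map_eq_zero]
  intro x hx
  obtain ⟨x, rfl⟩ := ZMod.intCast_surjective x
  rw [scale_intCast] at hx
  have hx' : (((p : ℤ) ^ k * x : ℤ) : ZMod (p ^ (k + 2))) = 0 := by exact_mod_cast hx
  rw [ZMod.intCast_zmod_eq_zero_iff_dvd] at hx' ⊢
  rw [Nat.cast_pow, pow_add] at hx'
  exact_mod_cast Int.dvd_of_mul_dvd_mul_left (by positivity) hx'

theorem sq_mul_eq_zero_iff (hp : 0 < p) (x : ZMod (p ^ (k + 2))) :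
    (p : ZMod (p ^ (k + 2))) ^ 2 * x = 0 ↔ ∃ y, scale p k y = x := by
  refine ⟨fun h => ?_, fun ⟨y, hy⟩ => hy ▸ sq_mul_scale y⟩
  obtain ⟨x, rfl⟩ := ZMod.intCast_surjective x
  have hx' : (((p : ℤ) ^ 2 * x : ℤ) : ZMod (p ^ (k + 2))) = 0 := by exact_mod_cast h
  rw [ZMod.intCast_zmod_eq_zero_iff_dvd, Nat.cast_pow, add_comm k, pow_add] at hx'
  obtain ⟨t, rfl⟩ := Int.dvd_of_mul_dvd_mul_left (by positivity) hx'
  exact ⟨t, by rw [scale_intCast]; push_cast; rfl⟩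

theorem red_eq_zero_iff (x : ZMod (p ^ (k + 2))) :
    red p k x = 0 ↔ ∃ y : ℤ, x = (p : ZMod (p ^ (k + 2))) ^ 2 * y := by
  refine ⟨fun h => ?_, fun ⟨y, hy⟩ => hy ▸ red_sq_mul _⟩
  obtain ⟨x, rfl⟩ := ZMod.intCast_surjective x
  rw [map_intCast, ZMod.intCast_zmod_eq_zero_iff_dvd] at h
  obtain ⟨t, rfl⟩ := h
  exact ⟨t, by push_cast; rfl⟩

theorem red_surjective : Function.Surjective (red p k) := ZMod.ringHom_surjective _

theorem card_red_ker (hp : 0 < p) : Nat.card {x : ZMod (p ^ (k + 2)) // red p k x = 0} = p ^ k := by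
  have h := AddSubgroup.card_eq_card_quotient_mul_card_addSubgroup (red p k).toAddMonoidHom.ker
  rw [Nat.card_congr (QuotientAddGroup.quotientKerEquivOfSurjective (red p k).toAddMonoidHom
    red_surjective).toEquiv, Nat.card_zmod, Nat.card_zmod, mul_comm] at h
  refine Nat.eq_of_mul_eq_mul_right (pow_pos hp 2) (Eq.trans ?_ (h.symm.trans (pow_add p k 2)))
  rfl

end ZModPowers

/-! ### The cocycle model. -/

/-- A concrete model of `JRYGroup p (m + 4)`: the product of four cyclic groups, with
addition twisted by a bilinear cocycle. -/
@[ext]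
structure JRYModel (p m : ℕ) where
  c0 : ZMod (p ^ (m + 2 + 2))
  c1 : ZMod (p ^ (2 + 2))
  c2 : ZMod (p ^ (2 + 2))
  c3 : ZMod (p ^ 2)

namespace JRYModel

variable {p m : ℕ}

/-- The first coordinate modulo `p ^ 2`. -/
def r0 (u : JRYModel p m) : ZMod (p ^ 2) := red p (m + 2) u.c0
/-- The second coordinate modulo `p ^ 2`. -/
def r1 (u : JRYModel p m) : ZMod (p ^ 2) := red p 2 u.c1
/-- The third coordinate modulo `p ^ 2`. -/
def r2 (u : JRYModel p m) : ZMod (p ^ 2) := red p 2 u.c2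

/-- The first component of the cocycle. -/
def b0 (u v : JRYModel p m) : ZMod (p ^ 2) := u.r1 * v.r2
/-- The second component of the cocycle. -/
def b1 (u v : JRYModel p m) : ZMod (p ^ 2) := u.r0 * v.r1 + u.r0 * v.r2 + u.r2 * v.c3
/-- The third component of the cocycle. -/
def b2 (u v : JRYModel p m) : ZMod (p ^ 2) := u.r0 * v.c3 + u.r1 * v.c3

/-- Each monomial of the cocycle pairs a lower-index coordinate of `u` with a higher-index one of
`v` and encodes one of the six commutator relations. Words with decreasing indices therefore receive
no correction. -/
instance : Mul (JRYModel p m) := ⟨fun u v =>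
  ⟨u.c0 + v.c0 + scale p (m + 2) (b0 u v), u.c1 + v.c1 + scale p 2 (b1 u v),
    u.c2 + v.c2 + scale p 2 (b2 u v), u.c3 + v.c3⟩⟩

instance : One (JRYModel p m) := ⟨⟨0, 0, 0, 0⟩⟩

instance : Inv (JRYModel p m) := ⟨fun u =>
  ⟨-u.c0 + scale p (m + 2) (b0 u u), -u.c1 + scale p 2 (b1 u u),
    -u.c2 + scale p 2 (b2 u u), -u.c3⟩⟩

@[simp] theorem one_c0 : (1 : JRYModel p m).c0 = 0 := rfl
@[simp] theorem one_c1 : (1 : JRYModel p m).c1 = 0 := rfl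
@[simp] theorem one_c2 : (1 : JRYModel p m).c2 = 0 := rfl
@[simp] theorem one_c3 : (1 : JRYModel p m).c3 = 0 := rfl
@[simp] theorem one_r0 : (1 : JRYModel p m).r0 = 0 := by simp [r0]
@[simp] theorem one_r1 : (1 : JRYModel p m).r1 = 0 := by simp [r1]
@[simp] theorem one_r2 : (1 : JRYModel p m).r2 = 0 := by simp [r2]

theorem mul_c0 (u v : JRYModel p m) :
    (u * v).c0 = u.c0 + v.c0 + scale p (m + 2) (b0 u v) := rfl
theorem mul_c1 (u v : JRYModel p m) : (u * v).c1 = u.c1 + v.c1 + scale p 2 (b1 u v) := rfl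
theorem mul_c2 (u v : JRYModel p m) : (u * v).c2 = u.c2 + v.c2 + scale p 2 (b2 u v) := rfl
@[simp] theorem mul_c3 (u v : JRYModel p m) : (u * v).c3 = u.c3 + v.c3 := rfl

@[simp] theorem mul_r0 (u v : JRYModel p m) : (u * v).r0 = u.r0 + v.r0 := by
  simp [r0, mul_c0, red_scale]
@[simp] theorem mul_r1 (u v : JRYModel p m) : (u * v).r1 = u.r1 + v.r1 := by
  simp [r1, mul_c1, red_scale]
@[simp] theorem mul_r2 (u v : JRYModel p m) : (u * v).r2 = u.r2 + v.r2 := by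
  simp [r2, mul_c2, red_scale]

theorem inv_c0 (u : JRYModel p m) : (u⁻¹).c0 = -u.c0 + scale p (m + 2) (b0 u u) := rfl
theorem inv_c1 (u : JRYModel p m) : (u⁻¹).c1 = -u.c1 + scale p 2 (b1 u u) := rfl
theorem inv_c2 (u : JRYModel p m) : (u⁻¹).c2 = -u.c2 + scale p 2 (b2 u u) := rfl
@[simp] theorem inv_c3' (u : JRYModel p m) : (u⁻¹).c3 = -u.c3 := rfl
@[simp] theorem inv_r0 (u : JRYModel p m) : (u⁻¹).r0 = -u.r0 := by simp [r0, inv_c0, red_scale]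
@[simp] theorem inv_r1 (u : JRYModel p m) : (u⁻¹).r1 = -u.r1 := by simp [r1, inv_c1, red_scale]
@[simp] theorem inv_r2 (u : JRYModel p m) : (u⁻¹).r2 = -u.r2 := by simp [r2, inv_c2, red_scale]

instance : Group (JRYModel p m) := Group.ofLeftAxioms
  (fun u v w => by
    ext
    · simp only [mul_c0, b0, mul_r1, mul_r2, add_mul, mul_add, map_add]; abel
    · simp only [mul_c1, b1, mul_r1, mul_r2, mul_r0, mul_c3, add_mul, mul_add, map_add]; abel
    · simp only [mul_c2, b2, mul_r1, mul_r0, mul_c3, add_mul, mul_add, map_add]; abel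
    · simp only [mul_c3]; abel)
  (fun u => by ext <;> simp [mul_c0, mul_c1, mul_c2, b0, b1, b2])
  (fun u => by
    ext
    · simp only [mul_c0, inv_c0, b0, inv_r1, neg_mul, map_neg, one_c0]; abel
    · simp only [mul_c1, inv_c1, b1, inv_r0, inv_r2, neg_mul, map_neg, map_add, one_c1]; abel
    · simp only [mul_c2, inv_c2, b2, inv_r0, inv_r1, neg_mul, map_neg, map_add, one_c2]; abel
    · simp)

/-- The homomorphisms given by the coordinates modulo `p ^ 2`. -/
def redHom (i : Fin 4) : JRYModel p m →* Multiplicative (ZMod (p ^ 2)) where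
  toFun u := Multiplicative.ofAdd (![u.r0, u.r1, u.r2, u.c3] i)
  map_one' := by fin_cases i <;> simp
  map_mul' u v := by fin_cases i <;> simp

theorem pow_r0 (u : JRYModel p m) (k : ℕ) : (u ^ k).r0 = k * u.r0 := by
  induction k with
  | zero => simp
  | succ k ih => rw [pow_succ u, mul_r0, ih]; push_cast; ring
theorem pow_r1 (u : JRYModel p m) (k : ℕ) : (u ^ k).r1 = k * u.r1 := by
  induction k with
  | zero => simp
  | succ k ih => rw [pow_succ u, mul_r1, ih]; push_cast; ring
theorem pow_r2 (u : JRYModel p m) (k : ℕ) : (u ^ k).r2 = k * u.r2 := by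
  induction k with
  | zero => simp
  | succ k ih => rw [pow_succ u, mul_r2, ih]; push_cast; ring
theorem pow_c3 (u : JRYModel p m) (k : ℕ) : (u ^ k).c3 = k * u.c3 := by
  induction k with
  | zero => simp
  | succ k ih => rw [pow_succ u, mul_c3, ih]; push_cast; ring

theorem pow_c0' (u : JRYModel p m) (k : ℕ) :
    (u ^ k).c0 = k * u.c0 + scale p (m + 2) (k.choose 2 * b0 u u) := by
  induction k with
  | zero => simp
  | succ k ih =>
    rw [pow_succ u, mul_c0, ih, Nat.choose_succ_succ' k 1, Nat.choose_one_right]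
    simp only [b0, pow_r1, Nat.cast_add, add_mul, map_add, mul_assoc, Nat.cast_one, one_mul]; abel
theorem pow_c1' (u : JRYModel p m) (k : ℕ) :
    (u ^ k).c1 = k * u.c1 + scale p 2 (k.choose 2 * b1 u u) := by
  induction k with
  | zero => simp
  | succ k ih =>
    rw [pow_succ u, mul_c1, ih, Nat.choose_succ_succ' k 1, Nat.choose_one_right]
    simp only [b1, pow_r0, pow_r2, Nat.cast_add, add_mul, mul_add, map_add, mul_assoc, Nat.cast_one,
      one_mul]; abel
theorem pow_c2' (u : JRYModel p m) (k : ℕ) :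
    (u ^ k).c2 = k * u.c2 + scale p 2 (k.choose 2 * b2 u u) := by
  induction k with
  | zero => simp
  | succ k ih =>
    rw [pow_succ u, mul_c2, ih, Nat.choose_succ_succ' k 1, Nat.choose_one_right]
    simp only [b2, pow_r0, pow_r1, Nat.cast_add, add_mul, mul_add, map_add, mul_assoc, Nat.cast_one,
      one_mul]; abel

theorem cast_pow_eq_zero {k : ℕ} (hk : 2 ≤ k) : ((p ^ k : ℕ) : ZMod (p ^ 2)) = 0 :=
  (ZMod.natCast_eq_zero_iff _ _).mpr (pow_dvd_pow p hk)
theorem pow_r0_eq_zero (u : JRYModel p m) {k : ℕ} (hk : 2 ≤ k) : (u ^ p ^ k).r0 = 0 := by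
  rw [pow_r0, cast_pow_eq_zero hk, zero_mul]
theorem pow_r1_eq_zero (u : JRYModel p m) {k : ℕ} (hk : 2 ≤ k) : (u ^ p ^ k).r1 = 0 := by
  rw [pow_r1, cast_pow_eq_zero hk, zero_mul]
theorem pow_r2_eq_zero (u : JRYModel p m) {k : ℕ} (hk : 2 ≤ k) : (u ^ p ^ k).r2 = 0 := by
  rw [pow_r2, cast_pow_eq_zero hk, zero_mul]
theorem pow_c3_eq_zero (u : JRYModel p m) {k : ℕ} (hk : 2 ≤ k) : (u ^ p ^ k).c3 = 0 := by
  rw [pow_c3, cast_pow_eq_zero hk, zero_mul]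

/-- This is where oddness of `p` enters: the quadratic correction in the power formula vanishes, so
raising to the power `p^k` acts coordinatewise. -/
theorem choose_two_cast (hodd : Odd p) {k : ℕ} (hk : 2 ≤ k) :
    (((p ^ k).choose 2 : ℕ) : ZMod (p ^ 2)) = 0 := by
  rw [ZMod.natCast_eq_zero_iff]
  obtain ⟨t, ht⟩ := hodd.pow (n := k)
  rw [Nat.choose_two_right]
  have : p ^ k * (p ^ k - 1) / 2 = p ^ k * t := by
    conv_lhs => rw [show p ^ k - 1 = 2 * t by omega]
    rw [show p ^ k * (2 * t) = 2 * (p ^ k * t) by ring]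
    simp
  rw [this]
  exact (pow_dvd_pow p hk).mul_right t

theorem pow_c0 (hodd : Odd p) (u : JRYModel p m) {k : ℕ} (hk : 2 ≤ k) :
    (u ^ p ^ k).c0 = (p : ZMod (p ^ (m + 2 + 2))) ^ k * u.c0 := by
  rw [pow_c0', choose_two_cast hodd hk]; simp
theorem pow_c1 (hodd : Odd p) (u : JRYModel p m) {k : ℕ} (hk : 2 ≤ k) :
    (u ^ p ^ k).c1 = (p : ZMod (p ^ (2 + 2))) ^ k * u.c1 := by
  rw [pow_c1', choose_two_cast hodd hk]; simp
theorem pow_c2 (hodd : Odd p) (u : JRYModel p m) {k : ℕ} (hk : 2 ≤ k) :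
    (u ^ p ^ k).c2 = (p : ZMod (p ^ (2 + 2))) ^ k * u.c2 := by
  rw [pow_c2', choose_two_cast hodd hk]; simp
-- In `u * v = z * (v * u)` the left factor `z` contributes no cocycle term, since the left argument
-- enters only through `r0`, `r1`, `r2`. What remains is the antisymmetrised cocycle.
theorem commutator_eq_iff (u v z : JRYModel p m) (h0 : z.r0 = 0) (h1 : z.r1 = 0)
    (h2 : z.r2 = 0) : ⁅u, v⁆ = z ↔
      scale p (m + 2) (b0 u v - b0 v u) = z.c0 ∧ scale p 2 (b1 u v - b1 v u) = z.c1 ∧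
        scale p 2 (b2 u v - b2 v u) = z.c2 ∧ 0 = z.c3 := by
  have : ⁅u, v⁆ = z ↔ u * v = z * (v * u) := by
    rw [commutatorElement_def, mul_inv_eq_iff_eq_mul, mul_inv_eq_iff_eq_mul, mul_assoc]
  rw [this, JRYModel.ext_iff]
  refine and_congr ?_ (and_congr ?_ (and_congr ?_ ?_))
  · simp only [mul_c0, b0, h1, zero_mul, map_zero, add_zero, map_sub]
    grind
  · simp only [mul_c1, b1, h0, h2, zero_mul, map_zero, add_zero, map_sub]
    grind
  · simp only [mul_c2, b2, h0, h1, zero_mul, map_zero, add_zero, map_sub]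
    grind
  · simp only [mul_c3]
    grind

/-- The standard generators. -/
def gen : Fin 4 → JRYModel p m := ![⟨1, 0, 0, 0⟩, ⟨0, 1, 0, 0⟩, ⟨0, 0, 1, 0⟩, ⟨0, 0, 0, 1⟩]

end JRYModel

/-! ### The centre of the model and rigidity of generating tuples. -/

namespace JRYModel

variable {p m : ℕ}

theorem mem_center_iff (hp : 0 < p) (u : JRYModel p m) :
    u ∈ Subgroup.center (JRYModel p m) ↔ u.r0 = 0 ∧ u.r1 = 0 ∧ u.r2 = 0 ∧ u.c3 = 0 := by
  have comm : ∀ u v : JRYModel p m, u * v = v * u ↔ b0 u v - b0 v u = 0 ∧ b1 u v - b1 v u = 0 ∧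
      b2 u v - b2 v u = 0 := fun u v => by
    rw [← commutatorElement_eq_one_iff_mul_comm, commutator_eq_iff u v 1 (by simp) (by simp) (by simp)]
    simp only [one_c0, one_c1, one_c2, one_c3, and_true,
      map_eq_zero_iff _ (scale_injective hp)]
  rw [Subgroup.mem_center_iff]
  constructor
  · intro h
    -- Commuting with the first two generators suffices: `gen 0` gives `r1 + r2 = 0` and `c3 = 0`,
    -- while `gen 1` gives `r0 = r2 = 0`.
    have h0 := (comm _ _).mp (h (gen 0))
    have h1 := (comm _ _).mp (h (gen 1))
    simp only [gen, Matrix.cons_val_zero, Matrix.cons_val_one, b0, b1, b2, r0, r1, r2, map_one,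
      map_zero] at h0 h1 ⊢
    grind
  · rintro ⟨h0, h1, h2, h3⟩ g
    rw [comm]
    simp [b0, b1, b2, h0, h1, h2, h3]

theorem jryRel_gen (hodd : Odd p) : JRYRel p (m + 4) (gen : Fin 4 → JRYModel p m) := by
  have z0 : (p : ZMod (p ^ (m + 2 + 2))) ^ (m + 4) = 0 := by
    exact_mod_cast ZMod.natCast_self (p ^ (m + 2 + 2))
  have z1 : (p : ZMod (p ^ (2 + 2))) ^ 4 = 0 := by
    exact_mod_cast ZMod.natCast_self (p ^ (2 + 2))
  have hs : ∀ k, scale p k 1 = (p : ZMod (p ^ (k + 2))) ^ k := fun k => by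
    have := scale_intCast (p := p) (k := k) 1
    simpa using this
  have e : m + 4 - 2 = m + 2 := rfl
  have h4 : 2 ≤ m + 4 := by omega
  have h2 : 2 ≤ m + 2 := by omega
  constructor
  · ext
    · rw [pow_c0 hodd _ h4, z0]; simp
    · rw [pow_c1 hodd _ h4]; simp [gen]
    · rw [pow_c2 hodd _ h4]; simp [gen]
    · rw [pow_c3_eq_zero _ h4]; simp
  · ext
    · rw [pow_c0 hodd _ (by norm_num)]; simp [gen]
    · rw [pow_c1 hodd _ (by norm_num), z1]; simp
    · rw [pow_c2 hodd _ (by norm_num)]; simp [gen]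
    · rw [pow_c3_eq_zero _ (by norm_num)]; simp
  · ext
    · rw [pow_c0 hodd _ (by norm_num)]; simp [gen]
    · rw [pow_c1 hodd _ (by norm_num)]; simp [gen]
    · rw [pow_c2 hodd _ (by norm_num), z1]; simp
    · rw [pow_c3_eq_zero _ (by norm_num)]; simp
  · ext
    · rw [pow_c0 hodd _ (by norm_num)]; simp [gen]
    · rw [pow_c1 hodd _ (by norm_num)]; simp [gen]
    · rw [pow_c2 hodd _ (by norm_num)]; simp [gen]
    · rw [pow_c3_eq_zero _ (by norm_num)]; simp
  all_goals
    try rw [e]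
    rw [commutator_eq_iff _ _ _ (pow_r0_eq_zero _ (by omega)) (pow_r1_eq_zero _ (by omega))
      (pow_r2_eq_zero _ (by omega))]
    refine ⟨?_, ?_, ?_, ?_⟩
    · rw [pow_c0 hodd _ (by omega)]
      simp [gen, b0, r1, r2, hs]
    · rw [pow_c1 hodd _ (by omega)]
      simp [gen, b1, r0, r1, r2, hs]
    · rw [pow_c2 hodd _ (by omega)]
      simp [gen, b2, r0, r1, hs]
    · rw [pow_c3_eq_zero _ (by omega)]

/-- A generating tuple satisfying the relations is congruent to the standard generators modulo the
centre. -/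
theorem red_eq_of_jryRel (hp : 0 < p) (hodd : Odd p) {y : Fin 4 → JRYModel p m}
    (hR : JRYRel p (m + 4) y) (hy : Subgroup.closure (Set.range y) = ⊤) (i j : Fin 4) :
    redHom j (y i) = redHom j (gen i : JRYModel p m) := by
  have S1 : ∀ u : JRYModel p m, (u ^ p ^ 2).c1 = scale p 2 u.r1 := fun u => by
    rw [pow_c1 hodd u le_rfl, r1, scale_red]
  have S2 : ∀ u : JRYModel p m, (u ^ p ^ 2).c2 = scale p 2 u.r2 := fun u => by
    rw [pow_c2 hodd u le_rfl, r2, scale_red]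
  have S0 : ∀ u : JRYModel p m, (u ^ p ^ (m + 2)).c0 = scale p (m + 2) u.r0 := fun u => by
    rw [pow_c0 hodd u (by omega), r0, scale_red]
  have Z0 : ∀ u : JRYModel p m, (u ^ p ^ 2).c0 = 0 → u.r0 = 0 := fun u hu => by
    rw [pow_c0 hodd u le_rfl, sq_mul_eq_zero_iff hp] at hu
    obtain ⟨w, hw⟩ := hu
    rw [r0, ← hw, red_scale (by omega)]
  have c {u v w : JRYModel p m} {k : ℕ} (hk : 2 ≤ k) (h : ⁅u, v⁆ = w ^ p ^ k) :=
    (commutator_eq_iff u v _ (pow_r0_eq_zero w hk) (pow_r1_eq_zero w hk)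
      (pow_r2_eq_zero w hk)).mp h
  -- The power relation on `y 3` kills its first three reduced coordinates. The commutators of `y 0`
  -- and `y 2` with `y 3` then have first coordinate zero, which kills `r0` of `y 2` and `y 1`.
  have h31 : (y 3).r1 = 0 := scale_injective (k := 2) hp (by
    rw [← S1, hR.pow3, map_zero, one_c1])
  have h32 : (y 3).r2 = 0 := scale_injective (k := 2) hp (by
    rw [← S2, hR.pow3, map_zero, one_c2])
  have h30 : (y 3).r0 = 0 := Z0 _ (by rw [hR.pow3, one_c0])
  have h20 : (y 2).r0 = 0 := Z0 _ (by
    rw [← (c le_rfl hR.comm03).1]; simp [b0, h31, h32])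
  have h10 : (y 1).r0 = 0 := Z0 _ (by
    rw [← (c le_rfl hR.comm23).1]; simp [b0, h31, h32])
  have inj := fun k => scale_injective (p := p) (k := k) hp
  have e03b := inj _ ((c le_rfl hR.comm03).2.1.trans (S1 _))
  have e03c := inj _ ((c le_rfl hR.comm03).2.2.1.trans (S2 _))
  have e13b := inj _ ((c le_rfl hR.comm13).2.1.trans (S1 _))
  have e13c := inj _ ((c le_rfl hR.comm13).2.2.1.trans (S2 _))
  have e23b := inj _ ((c le_rfl hR.comm23).2.1.trans (S1 _))
  have e23c := inj _ ((c le_rfl hR.comm23).2.2.1.trans (S2 _))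
  have e01b := inj _ ((c le_rfl hR.comm01).2.1.trans (S1 _))
  have e01c := inj _ ((c le_rfl hR.comm01).2.2.1.trans (S2 _))
  have e02b := inj _ ((c le_rfl hR.comm02).2.1.trans (S1 _))
  have e02c := inj _ ((c le_rfl hR.comm02).2.2.1.trans (S2 _))
  have e12a := inj _ ((c (by omega : 2 ≤ m + 2) hR.comm12).1.trans (S0 _))
  -- `⁅y 0, y 1⁆`, `⁅y 0, y 2⁆` and `⁅y 2, y 3⁆` all equal `y 1 ^ p ^ 2`, and the last one has first
  -- coordinate zero.
  have e01a : b0 (y 0) (y 1) - b0 (y 1) (y 0) = 0 := inj (m + 2) (by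
    rw [(c le_rfl hR.comm01).1, map_zero, pow_c0 hodd _ le_rfl, sq_mul_eq_zero_iff hp]
    have h := (c le_rfl hR.comm23).1
    rw [pow_c0 hodd _ le_rfl] at h
    have h' : (p : ZMod (p ^ (m + 2 + 2))) ^ 2 * (y 1).c0 = 0 := by
      rw [← h]; simp [b0, h31, h32]
    exact (sq_mul_eq_zero_iff hp _).mp h')
  have e02a : b0 (y 0) (y 2) - b0 (y 2) (y 0) = 0 := inj (m + 2) (by
    rw [(c le_rfl hR.comm02).1, ← (c le_rfl hR.comm01).1, e01a])
  -- surjectivity of the first coordinate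
  have hunit : ∃ k : ZMod (p ^ 2), k * (y 0).r0 = 1 := by
    have hle : Subgroup.closure (Set.range y) ≤ (Subgroup.zpowers (redHom 0 (y 0))).comap (redHom 0) := by
      rw [Subgroup.closure_le]
      rintro _ ⟨i, rfl⟩
      rw [SetLike.mem_coe, Subgroup.mem_comap]
      fin_cases i
      · exact Subgroup.mem_zpowers _
      · convert Subgroup.one_mem _; exact congrArg Multiplicative.ofAdd h10
      · convert Subgroup.one_mem _; exact congrArg Multiplicative.ofAdd h20
      · convert Subgroup.one_mem _; exact congrArg Multiplicative.ofAdd h30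
    rw [hy] at hle
    obtain ⟨k, hk⟩ := Subgroup.mem_zpowers_iff.mp (Subgroup.mem_comap.mp (hle (Subgroup.mem_top (gen 0))))
    have h1 : k • (y 0).r0 = (gen 0 : JRYModel p m).r0 := congrArg Multiplicative.toAdd hk
    refine ⟨k, ?_⟩
    rw [← zsmul_eq_mul, h1]
    simp [gen, r0]
  obtain ⟨k, hk⟩ := hunit
  simp only [b0, b1, b2, h10, h20, h30, h31, h32, zero_mul, mul_zero, sub_zero, add_zero,
    zero_add] at e01a e02a e12a e01b e01c e02b e02c e03b e03c e13b e13c e23b e23c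
  have key : (y 0).r0 = 1 ∧ (y 0).r1 = 0 ∧ (y 0).r2 = 0 ∧ (y 0).c3 = 0 ∧ (y 1).r1 = 1 ∧
      (y 1).r2 = 0 ∧ (y 1).c3 = 0 ∧ (y 2).r1 = 0 ∧ (y 2).r2 = 1 ∧ (y 2).c3 = 0 ∧ (y 3).c3 = 1 := by
    generalize (y 0).r0 = a0 at *
    generalize (y 0).r1 = a1 at *
    generalize (y 0).r2 = a2 at *
    generalize (y 0).c3 = a3 at *
    generalize (y 1).r1 = b1 at *
    generalize (y 1).r2 = b2 at *
    generalize (y 1).c3 = b3 at *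
    generalize (y 2).r1 = c1 at *
    generalize (y 2).r2 = c2 at *
    generalize (y 2).c3 = c3 at *
    generalize (y 3).c3 = d at *
    -- Substituting `c1 = b2 * d` and `c2 = b1 * d` in `b1 * c2 - c1 * b2 = a0`, with `k` inverse to
    -- `a0`, shows that `d` is a unit and can be cancelled.
    have hd : k * (b1 ^ 2 - b2 ^ 2) * d = 1 := by grind
    have cancel : ∀ {x}, x * d = 0 → x = 0 := fun {x} hx => by
      linear_combination -x * hd + k * (b1 ^ 2 - b2 ^ 2) * hx
    have h1 : a2 = b2 := sub_eq_zero.mp (cancel (by grind))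
    have h2 : b1 = a0 + a1 := sub_eq_zero.mp (cancel (by grind))
    have h3 : b2 = 0 := by linear_combination -b2 * hk - k * (e01a + b1 * h1 + b2 * h2)
    subst h1 h2 h3
    have h4 : c1 = 0 := by rw [← e13b, zero_mul]
    subst h4
    have h5 : k * (a0 + a1) * c2 = 1 := by grind
    have h6 : a1 = 0 := by grind
    subst h6
    -- By now `b1 = a0`, and the relation for `⁅y 0, y 1⁆` reads `a0 ^ 2 = a0` with `a0` a unit.
    have h7 : a0 = 1 := by grind
    subst h7
    have h8 : c2 = 1 := by grind
    have h9 : d = 1 := by grind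
    subst h8 h9
    grind
  obtain ⟨k00, k01, k02, k03, k11, k12, k13, k21, k22, k23, k33⟩ := key
  refine congrArg Multiplicative.ofAdd ?_
  fin_cases i <;> fin_cases j <;> simp [*] <;> simp [gen, r0, r1, r2]

end JRYModel

/-! ### General facts on Frattini subgroups and central factors. -/

/-- Maximal subgroups `K` are normal by nilpotency. If `g ^ p ∉ K`, then `K` and `g ^ p` generate
`G`, so in `G ⧸ K` the image of `g` is a power of its own `p`-th power; iterating makes it trivial,
a contradiction. -/
theorem IsPGroup.pow_mem_frattini {p : ℕ} [Fact p.Prime] {G : Type*} [Group G] [Finite G]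
    (hG : IsPGroup p G) (g : G) : g ^ p ∈ frattini G := by
  rw [frattini, Order.radical, Subgroup.mem_iInf]
  intro K
  rw [Subgroup.mem_iInf]
  intro hK
  have : Group.IsNilpotent G := hG.isNilpotent
  have hn : K.Normal := Subgroup.NormalizerCondition.normal_of_coatom K
    Group.normalizerCondition_of_isNilpotent hK
  by_contra hg
  have htop : K ⊔ Subgroup.zpowers (g ^ p) = ⊤ := by
    refine hK.2 _ (lt_of_le_of_ne le_sup_left fun h => hg ?_)
    rw [h]
    exact le_sup_right (a := K) (Subgroup.mem_zpowers (g ^ p))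
  set q := QuotientGroup.mk' K
  have hq : q g ∈ Subgroup.zpowers (q (g ^ p)) := by
    have h := Subgroup.mem_map_of_mem q (htop ▸ Subgroup.mem_top g : g ∈ K ⊔ Subgroup.zpowers (g ^ p))
    rwa [Subgroup.map_sup, QuotientGroup.map_mk'_self, bot_sup_eq, MonoidHom.map_zpowers] at h
  obtain ⟨k, hk⟩ := Subgroup.mem_zpowers_iff.mp hq
  have iter : ∀ j : ℕ, (q g) ^ (((p : ℤ) * k) ^ j) = q g := fun j => by
    induction j with
    | zero => simp
    | succ j ih =>
      rw [pow_succ, zpow_mul, ih, zpow_mul, zpow_natCast, ← map_pow, hk]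
  obtain ⟨j, hj⟩ := hG g
  have h1 : q g = 1 := by
    rw [← iter j, mul_pow, zpow_mul, ← Nat.cast_pow, zpow_natCast, ← map_pow, hj, map_one, one_zpow]
  have hgK : g ∈ K := (QuotientGroup.eq_one_iff g).mp h1
  exact hg (K.pow_mem hgK p)

theorem commutatorElement_mul_center {G : Type*} [Group G] {g h z w : G}
    (hz : z ∈ Subgroup.center G) (hw : w ∈ Subgroup.center G) : ⁅g * z, h * w⁆ = ⁅g, h⁆ := by
  rw [Subgroup.mem_center_iff] at hz hw
  rw [commutatorElement_def, commutatorElement_def, mul_inv_eq_iff_eq_mul, mul_inv_eq_iff_eq_mul]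
  calc g * z * (h * w) = g * (z * h) * w := by group
    _ = g * h * z * w := by rw [← hz h]; group
    _ = g * h * g⁻¹ * h⁻¹ * (h * g) * z * w := by group
    _ = g * h * g⁻¹ * h⁻¹ * (h * (g * z * w)) := by group
    _ = g * h * g⁻¹ * h⁻¹ * (h * (w * (g * z))) := by rw [hw (g * z)]
    _ = _ := by group

/-! ### Coordinates of words, and the isomorphism with the presented group. -/

namespace JRYModel

variable {p m : ℕ}

theorem gen_zpow0 (i : ℤ) : (gen 0 : JRYModel p m) ^ i = ⟨i, 0, 0, 0⟩ := by
  let f : Multiplicative ℤ →* JRYModel p m :=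
    { toFun := fun i => ⟨(i.toAdd : ℤ), 0, 0, 0⟩
      map_one' := by ext <;> simp
      map_mul' := fun a b => by
        ext <;> simp [mul_c0, mul_c1, mul_c2, b0, b1, b2, r1, r2] }
  have h := map_zpow f (Multiplicative.ofAdd 1) i
  rw [← ofAdd_zsmul] at h
  simpa [f, gen] using h.symm

theorem gen_zpow1 (i : ℤ) : (gen 1 : JRYModel p m) ^ i = ⟨0, i, 0, 0⟩ := by
  let f : Multiplicative ℤ →* JRYModel p m :=
    { toFun := fun i => ⟨0, (i.toAdd : ℤ), 0, 0⟩
      map_one' := by ext <;> simp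
      map_mul' := fun a b => by
        ext <;> simp [mul_c0, mul_c1, mul_c2, b0, b1, b2, r0, r2] }
  have h := map_zpow f (Multiplicative.ofAdd 1) i
  rw [← ofAdd_zsmul] at h
  simpa [f, gen] using h.symm

theorem gen_zpow2 (i : ℤ) : (gen 2 : JRYModel p m) ^ i = ⟨0, 0, i, 0⟩ := by
  let f : Multiplicative ℤ →* JRYModel p m :=
    { toFun := fun i => ⟨0, 0, (i.toAdd : ℤ), 0⟩
      map_one' := by ext <;> simp
      map_mul' := fun a b => by
        ext <;> simp [mul_c0, mul_c1, mul_c2, b0, b1, b2, r0, r1] }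
  have h := map_zpow f (Multiplicative.ofAdd 1) i
  rw [← ofAdd_zsmul] at h
  simpa [f, gen] using h.symm

theorem gen_zpow3 (i : ℤ) : (gen 3 : JRYModel p m) ^ i = ⟨0, 0, 0, i⟩ := by
  let f : Multiplicative ℤ →* JRYModel p m :=
    { toFun := fun i => ⟨0, 0, 0, (i.toAdd : ℤ)⟩
      map_one' := by ext <;> simp
      map_mul' := fun a b => by
        ext <;> simp [mul_c0, mul_c1, mul_c2, b0, b1, b2, r0, r1, r2] }
  have h := map_zpow f (Multiplicative.ofAdd 1) i
  rw [← ofAdd_zsmul] at h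
  simpa [f, gen] using h.symm

theorem gen_word (i j k l : ℤ) :
    (gen 3 : JRYModel p m) ^ l * (gen 2 ^ k * (gen 1 ^ j * gen 0 ^ i)) = ⟨i, j, k, l⟩ := by
  rw [gen_zpow0, gen_zpow1, gen_zpow2, gen_zpow3]
  ext <;> simp [mul_c0, mul_c1, mul_c2, b0, b1, b2, r0, r1, r2]

/-- The coordinates as an equivalence of types. -/
def equivProd : JRYModel p m ≃ ZMod (p ^ (m + 2 + 2)) × ZMod (p ^ (2 + 2)) × ZMod (p ^ (2 + 2)) ×
    ZMod (p ^ 2) where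
  toFun u := (u.c0, u.c1, u.c2, u.c3)
  invFun v := ⟨v.1, v.2.1, v.2.2.1, v.2.2.2⟩

theorem card_eq : Nat.card (JRYModel p m) = p ^ (m + 4 + 10) := by
  rw [Nat.card_congr equivProd]
  simp only [Nat.card_prod, Nat.card_zmod]
  ring

/-- Multiplication of the first coordinate by `p ^ 2`. -/
def sqHom : JRYModel p m →* Multiplicative (ZMod (p ^ (m + 2 + 2))) where
  toFun u := Multiplicative.ofAdd ((p : ZMod (p ^ (m + 2 + 2))) ^ 2 * u.c0)
  map_one' := by simp
  map_mul' u v := by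
    rw [← ofAdd_add, mul_c0, mul_add, mul_add, sq_mul_scale, add_zero]

theorem sqHom_eq_one_iff (u : JRYModel p m) :
    sqHom u = 1 ↔ (p : ZMod (p ^ (m + 2 + 2))) ^ 2 * u.c0 = 0 := Iff.rfl

theorem forall_redHom_iff (u : JRYModel p m) :
    (∀ j, redHom j u = 1) ↔ u.r0 = 0 ∧ u.r1 = 0 ∧ u.r2 = 0 ∧ u.c3 = 0 := by
  rw [Fin.forall_fin_succ, Fin.forall_fin_succ, Fin.forall_fin_succ, Fin.forall_fin_one]
  rfl

end JRYModel

theorem jryRel_of (p n : ℕ) :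
    JRYRel p n (PresentedGroup.of : Fin 4 → JRYGroup p n) := by
  rw [jryRel_iff]
  intro r hr
  have : FreeGroup.lift (PresentedGroup.of : Fin 4 → JRYGroup p n) =
      PresentedGroup.mk (jryRelators p n) := by
    ext i; simp [PresentedGroup.of]
  rw [this]
  exact PresentedGroup.one_of_mem hr

namespace JRYGroup

open JRYModel

variable {p m : ℕ}

/-- The generators of `JRYGroup p n`. -/
abbrev x {n : ℕ} (i : Fin 4) : JRYGroup p n := PresentedGroup.of i

theorem closure_x {n : ℕ} : Subgroup.closure (Set.range (x : Fin 4 → JRYGroup p n)) = ⊤ :=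
  PresentedGroup.closure_range_of _

/-- The homomorphism to the model. -/
def toModel (hodd : Odd p) : JRYGroup p (m + 4) →* JRYModel p m :=
  PresentedGroup.toGroup ((jryRel_iff _).mp (jryRel_gen hodd))

theorem toModel_x (hodd : Odd p) (i : Fin 4) : toModel (m := m) hodd (x i) = gen i :=
  PresentedGroup.toGroup.of _

theorem exists_word (hodd : Odd p) (g : JRYGroup p (m + 4)) : ∃ i j k l : ℤ,
    g = x 3 ^ l * (x 2 ^ k * (x 1 ^ j * x 0 ^ i)) ∧ toModel hodd g = ⟨i, j, k, l⟩ := by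
  obtain ⟨i, j, k, l, rfl⟩ := (jryRel_of p (m + 4)).exists_normal_form (by omega) closure_x g
  refine ⟨i, j, k, l, rfl, ?_⟩
  simp only [map_mul, map_zpow, toModel_x, gen_word]

theorem zpow_eq_one_of_cast {G : Type*} [Group G] {g : G} {k : ℕ} (hg : g ^ k = 1) {i : ℤ}
    (hi : (i : ZMod k) = 0) : g ^ i = 1 := by
  obtain ⟨t, rfl⟩ := (ZMod.intCast_zmod_eq_zero_iff_dvd i k).mp hi
  rw [zpow_mul, zpow_natCast, hg, one_zpow]

/-- The coordinates of a normal-form word are its exponents modulo the orders in the presentation.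
If all vanish, the power relations make every factor trivial. -/
theorem toModel_bijective (hodd : Odd p) : Function.Bijective (toModel (m := m) hodd) := by
  constructor
  · rw [injective_iff_map_eq_one]
    intro g hg
    obtain ⟨i, j, k, l, rfl, h⟩ := exists_word hodd g
    rw [hg, JRYModel.ext_iff] at h
    have R := jryRel_of p (m + 4)
    rw [zpow_eq_one_of_cast R.pow0 h.1.symm, zpow_eq_one_of_cast R.pow1 h.2.1.symm,
      zpow_eq_one_of_cast R.pow2 h.2.2.1.symm, zpow_eq_one_of_cast R.pow3 h.2.2.2.symm]
    simp
  · rintro ⟨a, b, c, d⟩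
    obtain ⟨i, rfl⟩ := ZMod.intCast_surjective a
    obtain ⟨j, rfl⟩ := ZMod.intCast_surjective b
    obtain ⟨k, rfl⟩ := ZMod.intCast_surjective c
    obtain ⟨l, rfl⟩ := ZMod.intCast_surjective d
    exact ⟨x 3 ^ l * (x 2 ^ k * (x 1 ^ j * x 0 ^ i)), by
      simp only [map_mul, map_zpow, toModel_x, gen_word]⟩

/-- The isomorphism with the model. -/
noncomputable def equivModel (hodd : Odd p) : JRYGroup p (m + 4) ≃* JRYModel p m :=
  MulEquiv.ofBijective (toModel hodd) (toModel_bijective hodd)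

theorem card_eq (hodd : Odd p) : Nat.card (JRYGroup p (m + 4)) = p ^ (m + 4 + 10) := by
  rw [Nat.card_congr (equivModel hodd).toEquiv, JRYModel.card_eq]

theorem finite (hodd : Odd p) : Finite (JRYGroup p (m + 4)) :=
  Nat.finite_of_card_ne_zero (by rw [card_eq hodd]; exact (pow_pos hodd.pos _).ne')

theorem mem_center_iff (hodd : Odd p) (g : JRYGroup p (m + 4)) :
    g ∈ Subgroup.center (JRYGroup p (m + 4)) ↔ ∀ j, redHom j (toModel hodd g) = 1 := by
  rw [forall_redHom_iff, ← JRYModel.mem_center_iff hodd.pos, Subgroup.mem_center_iff,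
    Subgroup.mem_center_iff, (toModel_bijective hodd).2.forall]
  simp only [← map_mul, (toModel_bijective hodd).1.eq_iff]

theorem pow_sq_commutator_mem {n : ℕ} (k : ℕ) {u v w : JRYGroup p n} (h : ⁅u, v⁆ = w ^ k) (t : ℤ) :
    w ^ (k * t : ℤ) ∈ commutator (JRYGroup p n) := by
  rw [zpow_mul, zpow_natCast, ← h]
  exact Subgroup.zpow_mem _ (Subgroup.commutator_mem_commutator (Subgroup.mem_top u)
    (Subgroup.mem_top v)) _

/-- A central element is the product of a commutator and a power of `x₁ ^ (p ^ 2)`. -/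
theorem exists_mul_of_mem_center (hodd : Odd p) {g : JRYGroup p (m + 4)}
    (hg : g ∈ Subgroup.center (JRYGroup p (m + 4))) :
    ∃ t ∈ commutator (JRYGroup p (m + 4)), ∃ s : ℤ, g = t * x 0 ^ ((p ^ 2 : ℕ) * s : ℤ) ∧
      (toModel hodd g).c0 = ((p ^ 2 : ℕ) * s : ℤ) := by
  have R := jryRel_of p (m + 4)
  rw [mem_center_iff hodd, forall_redHom_iff] at hg
  obtain ⟨i, j, k, l, hw, h⟩ := exists_word hodd g
  rw [h] at hg ⊢
  obtain ⟨h0, h1, h2, h3⟩ := hg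
  simp only [r0, r1, r2, map_intCast] at h0 h1 h2 h3
  rw [zpow_eq_one_of_cast R.pow3 h3, one_mul] at hw
  rw [ZMod.intCast_zmod_eq_zero_iff_dvd] at h0 h1 h2
  obtain ⟨i, rfl⟩ := h0
  obtain ⟨j, rfl⟩ := h1
  obtain ⟨k, rfl⟩ := h2
  refine ⟨_, mul_mem (pow_sq_commutator_mem _ R.comm03 k) (pow_sq_commutator_mem _ R.comm01 j), i, ?_, rfl⟩
  rw [hw, mul_assoc]

/-- Commutators die under the maps `redHom j` and `sqHom` to abelian groups. Conversely, modulo `γ₂`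
a central element is a power of `x₁^(p^2)`; if `sqHom` kills it, `p^(m+2)` divides the exponent and
`⁅x₂, x₃⁆ = x₁^(p^(m+2))` accounts for it. -/
theorem mem_commutator_iff (hodd : Odd p) (g : JRYGroup p (m + 4)) :
    g ∈ commutator (JRYGroup p (m + 4)) ↔
      g ∈ Subgroup.center (JRYGroup p (m + 4)) ∧ sqHom (toModel hodd g) = 1 := by
  constructor
  · intro hg
    refine ⟨(mem_center_iff hodd g).mpr fun j => ?_, ?_⟩
    · exact Abelianization.commutator_subset_ker ((redHom j).comp (toModel hodd)) hg
    · exact Abelianization.commutator_subset_ker (sqHom.comp (toModel hodd)) hg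
  · rintro ⟨hg, hs⟩
    obtain ⟨t, ht, s, hs', h⟩ := exists_mul_of_mem_center hodd hg
    rw [hs']
    refine mul_mem ht ?_
    rw [sqHom_eq_one_iff, h] at hs
    have hs2 : (((p ^ 2 * (p ^ 2 * s) : ℤ)) : ZMod (p ^ (m + 2 + 2))) = 0 := by
      push_cast at hs ⊢; exact hs
    rw [ZMod.intCast_zmod_eq_zero_iff_dvd] at hs2
    have hp0 : ((p : ℤ) ^ 2) ≠ 0 := pow_ne_zero _ (by exact_mod_cast hodd.pos.ne')
    have : (p : ℤ) ^ (m + 2) ∣ p ^ 2 * s := by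
      refine Int.dvd_of_mul_dvd_mul_left hp0 ?_
      rwa [mul_comm, ← pow_add, ← Nat.cast_pow]
    obtain ⟨r, hr⟩ := this
    have h' := pow_sq_commutator_mem (p ^ (m + 2)) (jryRel_of p (m + 4)).comm12 r
    rw [Nat.cast_pow] at h' ⊢
    rwa [hr]

end JRYGroup

/-! ### Automorphisms: centrality, commutativity, existence. -/

namespace JRYGroup

open JRYModel

variable {p m : ℕ}

local notation "G" => JRYGroup p (m + 4)

theorem pow_sq_eq_one (hodd : Odd p) {g : G} (hg : g ∈ commutator G) : g ^ p ^ 2 = 1 := by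
  obtain ⟨hc, hs⟩ := (mem_commutator_iff hodd g).mp hg
  rw [mem_center_iff hodd, forall_redHom_iff] at hc
  apply (toModel_bijective hodd).1
  rw [map_pow, map_one]
  ext
  · rw [JRYModel.pow_c0 hodd _ le_rfl]; exact hs
  · rw [JRYModel.pow_c1 hodd _ le_rfl, ← scale_red]; exact (congrArg _ hc.2.1).trans (map_zero _)
  · rw [JRYModel.pow_c2 hodd _ le_rfl, ← scale_red]; exact (congrArg _ hc.2.2.1).trans (map_zero _)
  · rw [pow_c3_eq_zero _ le_rfl]; rfl

theorem pow_eq_one_of_mem_center (hodd : Odd p) {g : G} (hg : g ∈ Subgroup.center G) :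
    g ^ p ^ (m + 2) = 1 := by
  rw [mem_center_iff hodd, forall_redHom_iff] at hg
  have h2 : 2 ≤ m + 2 := by omega
  have key : ∀ y : ZMod (p ^ (2 + 2)), red p 2 y = 0 → (p : ZMod (p ^ (2 + 2))) ^ (m + 2) * y = 0 :=
    fun y hy => by rw [pow_add (p : ZMod (p ^ (2 + 2))), mul_assoc, ← scale_red, hy, map_zero, mul_zero]
  apply (toModel_bijective hodd).1
  rw [map_pow, map_one]
  ext
  · rw [JRYModel.pow_c0 hodd _ h2, ← scale_red]; exact (congrArg _ hg.1).trans (map_zero _)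
  · rw [JRYModel.pow_c1 hodd _ h2]; exact key _ hg.2.1
  · rw [JRYModel.pow_c2 hodd _ h2]; exact key _ hg.2.2.1
  · rw [pow_c3_eq_zero _ h2]; rfl

theorem exists_pow_of_mem_center (hodd : Odd p) {g : G} (hg : g ∈ Subgroup.center G) :
    ∃ h : G, g = h ^ p ^ 2 := by
  rw [mem_center_iff hodd, forall_redHom_iff] at hg
  obtain ⟨h0, h1, h2, h3⟩ := hg
  obtain ⟨a, ha⟩ := (red_eq_zero_iff _).mp h0
  obtain ⟨b, hb⟩ := (red_eq_zero_iff _).mp h1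
  obtain ⟨c, hc⟩ := (red_eq_zero_iff _).mp h2
  obtain ⟨h, hh⟩ := (toModel_bijective hodd).2 (⟨a, b, c, 0⟩ : JRYModel p m)
  refine ⟨h, (toModel_bijective hodd).1 ?_⟩
  rw [map_pow, hh]
  ext
  · rw [JRYModel.pow_c0 hodd _ le_rfl, ha]
  · rw [JRYModel.pow_c1 hodd _ le_rfl, hb]
  · rw [JRYModel.pow_c2 hodd _ le_rfl, hc]
  · rw [pow_c3_eq_zero _ le_rfl, h3]

theorem isPGroup (hodd : Odd p) : IsPGroup p G := IsPGroup.of_card (card_eq hodd)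

theorem center_le_frattini (hp : p.Prime) (hodd : Odd p) : Subgroup.center G ≤ frattini G := by
  intro g hg
  have := Fact.mk hp
  have := finite (m := m) hodd
  obtain ⟨h, rfl⟩ := exists_pow_of_mem_center hodd hg
  rw [sq, pow_mul]
  exact (isPGroup hodd).pow_mem_frattini _

/-- The images of the generators again generate and satisfy the relations, so by rigidity `α`
preserves every `redHom j`; the common kernel of these maps is the centre. -/
theorem aut_central (hodd : Odd p) (α : MulAut G) (g : G) :
    g⁻¹ * α g ∈ Subgroup.center G := by
  have hR := ((jryRel_of p (m + 4)).map α.toMonoidHom).map (toModel (m := m) hodd)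
  have hcl : Subgroup.closure (Set.range fun i => toModel (m := m) hodd (α (x i))) = ⊤ := by
    have : Set.range (fun i => toModel (m := m) hodd (α (x i))) =
        ((toModel (m := m) hodd).comp α.toMonoidHom) '' Set.range x := by
      rw [← Set.range_comp]; rfl
    rw [this, ← MonoidHom.map_closure, closure_x]
    exact Subgroup.map_top_of_surjective _ ((toModel_bijective hodd).2.comp α.surjective)
  rw [mem_center_iff hodd]
  intro j
  have e : ((redHom j).comp (toModel (m := m) hodd)).comp α.toMonoidHom =
      (redHom j).comp (toModel hodd) := by
    refine PresentedGroup.ext fun i => ?_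
    have := red_eq_of_jryRel hodd.pos hodd hR hcl i j
    exact this.trans (congrArg _ (toModel_x hodd i).symm)
  have eg : redHom j (toModel hodd (α g)) = redHom j (toModel hodd g) := DFunLike.congr_fun e g
  rw [map_mul, map_mul, eg, map_inv, map_inv, inv_mul_cancel]

theorem aut_apply_commutator (hodd : Odd p) (α : MulAut G) {g : G} (hg : g ∈ commutator G) :
    α g = g := by
  have : commutator G ≤ α.toMonoidHom.eqLocus (MonoidHom.id _) := by
    rw [commutator_def, Subgroup.commutator_le]
    intro a _ b _
    change α ⁅a, b⁆ = ⁅a, b⁆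
    have := commutatorElement_mul_center (g := a) (h := b) (aut_central hodd α a)
      (aut_central hodd α b)
    rwa [mul_inv_cancel_left, mul_inv_cancel_left, ← map_commutatorElement] at this
  exact this hg

/-- For `i ≠ 0` the power `x i ^ p ^ 2` is a commutator or trivial, hence fixed by `α`. The central
displacement thus has trivial `p^2`-th power, which is the condition for lying in `γ₂`. -/
theorem aut_displacement_mem_commutator (hodd : Odd p) (α : MulAut G) {i : Fin 4} (hi : i ≠ 0) :
    (x i)⁻¹ * α (x i) ∈ commutator G := by
  have hz := aut_central hodd α (x i)
  refine (mem_commutator_iff hodd _).mpr ⟨hz, ?_⟩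
  have hcomm := Subgroup.mem_center_iff.mp hz (x i)
  set z := (x i)⁻¹ * α (x i) with hzdef
  have hα : α (x i) = x i * z := by rw [hzdef, mul_inv_cancel_left]
  have hfix : α ((x i) ^ p ^ 2) = (x i) ^ p ^ 2 := by
    have R := jryRel_of p (m + 4)
    apply aut_apply_commutator hodd
    have key := fun {u v : G} (h : ⁅u, v⁆ = x i ^ p ^ 2) => pow_sq_commutator_mem _ h 1
    simp only [mul_one, zpow_natCast] at key
    fin_cases i
    · exact absurd rfl hi
    · exact key R.comm01
    · exact key R.comm03
    · exact R.pow3 ▸ one_mem _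
  rw [map_pow, hα, (show Commute (x i) z from hcomm).mul_pow, mul_eq_left] at hfix
  have h := congrArg (fun g => (toModel hodd g).c0) hfix
  simp only [map_pow, map_one] at h
  rw [JRYModel.pow_c0 hodd _ le_rfl] at h
  exact h

/-- On `x₂, x₃, x₄` the displacements lie in `γ₂`, which both automorphisms fix. On `x₁`, each acts
on powers of `x₁^(p^2)` by an exponent `1 + p^2 s`, and such exponents multiply commutatively. -/
theorem aut_comm (hodd : Odd p) (α β : MulAut G) : α * β = β * α := by
  have hC : commutator G ≤ Subgroup.center G := fun g hg => ((mem_commutator_iff hodd g).mp hg).1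
  have hgen : (α * β).toMonoidHom = (β * α).toMonoidHom := by
    refine PresentedGroup.ext fun i => ?_
    change α (β (x i)) = β (α (x i))
    by_cases hi : i = 0
    · subst hi
      -- the image of `x₁` determines the action on the centre
      have main : ∀ α β : MulAut G, ∃ t s t' s', α (x 0) = x 0 * (t * x 0 ^ ((p ^ 2 : ℕ) * s : ℤ)) ∧
          β (x 0) = x 0 * (t' * x 0 ^ ((p ^ 2 : ℕ) * s' : ℤ)) ∧ t ∈ commutator G ∧
          t' ∈ commutator G ∧ x 0 ^ ((p ^ 2 : ℕ) * s : ℤ) ∈ Subgroup.center G ∧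
          x 0 ^ ((p ^ 2 : ℕ) * s' : ℤ) ∈ Subgroup.center G := by
        intro α β
        obtain ⟨t, ht, s, hs, -⟩ := exists_mul_of_mem_center hodd (aut_central hodd α (x 0))
        obtain ⟨t', ht', s', hs', -⟩ := exists_mul_of_mem_center hodd (aut_central hodd β (x 0))
        refine ⟨t, s, t', s', by rw [← hs, mul_inv_cancel_left], by rw [← hs', mul_inv_cancel_left],
          ht, ht', ?_, ?_⟩
        · have := mul_mem (inv_mem (hC ht)) (aut_central hodd α (x 0))
          rwa [hs, inv_mul_cancel_left] at this
        · have := mul_mem (inv_mem (hC ht')) (aut_central hodd β (x 0))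
          rwa [hs', inv_mul_cancel_left] at this
      obtain ⟨t, s, t', s', hα, hβ, ht, ht', hs, hs'⟩ := main α β
      -- The factor `t ∈ γ₂` disappears because the exponent is a multiple of `p^2`.
      have act : ∀ (γ : MulAut G) (t : G) (s r : ℤ), γ (x 0) = x 0 * (t * x 0 ^ ((p ^ 2 : ℕ) * s : ℤ)) →
          t ∈ commutator G → x 0 ^ ((p ^ 2 : ℕ) * s : ℤ) ∈ Subgroup.center G →
          γ (x 0 ^ ((p ^ 2 : ℕ) * r : ℤ)) =
            x 0 ^ ((p ^ 2 : ℕ) * r : ℤ) * x 0 ^ ((p ^ 2 : ℕ) * s * ((p ^ 2 : ℕ) * r) : ℤ) := by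
        intro γ t s r hγ ht hs
        have c1 : Commute (x 0) (t * x 0 ^ ((p ^ 2 : ℕ) * s : ℤ)) :=
          Subgroup.mem_center_iff.mp (mul_mem (hC ht) hs) _
        have c2 : Commute t (x 0 ^ ((p ^ 2 : ℕ) * s : ℤ)) := Subgroup.mem_center_iff.mp hs _
        rw [map_zpow, hγ, c1.mul_zpow, c2.mul_zpow, zpow_mul t, zpow_natCast, pow_sq_eq_one hodd ht,
          one_zpow, one_mul, ← zpow_mul (x 0) ((p ^ 2 : ℕ) * s : ℤ)]
      rw [hα, hβ, map_mul, map_mul, map_mul, map_mul, aut_apply_commutator hodd α ht',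
        aut_apply_commutator hodd β ht, act α t s s' hα ht hs, act β t' s' s hβ ht' hs', hα, hβ]
      rw [show ((p ^ 2 : ℕ) * s' * ((p ^ 2 : ℕ) * s) : ℤ) = (p ^ 2 : ℕ) * s * ((p ^ 2 : ℕ) * s') by ring]
      have c3 := Subgroup.mem_center_iff.mp (mul_mem (hC ht) hs)
        (t' * x 0 ^ ((p ^ 2 : ℕ) * s' : ℤ))
      have c4 := congrArg
        (fun g => x 0 * (g * x 0 ^ ((p ^ 2 : ℕ) * s * ((p ^ 2 : ℕ) * s') : ℤ))) c3
      simpa only [mul_assoc] using c4.symm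
    · have ha := aut_displacement_mem_commutator hodd α hi
      have hb := aut_displacement_mem_commutator hodd β hi
      have h1 := aut_apply_commutator hodd α hb
      have h2 := aut_apply_commutator hodd β ha
      rw [map_mul, map_inv, inv_mul_eq_iff_eq_mul] at h1 h2
      rw [h1, h2]
      have := Subgroup.mem_center_iff.mp (hC ha) ((x i)⁻¹ * β (x i))
      rw [show α (x i) = x i * ((x i)⁻¹ * α (x i)) by rw [mul_inv_cancel_left], mul_assoc, ← this]
      simp only [mul_assoc, mul_inv_cancel_left]
  exact MulEquiv.toMonoidHom_injective hgen

/-- Every admissible central displacement of the generators gives an automorphism. -/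
theorem exists_aut (hp : p.Prime) (hodd : Odd p) (z : Fin 4 → G) (h0 : z 0 ∈ Subgroup.center G)
    (hz : ∀ i, i ≠ 0 → z i ∈ commutator G) : ∃ α : MulAut G, ∀ i, α (x i) = x i * z i := by
  have R := jryRel_of p (m + 4)
  have := finite (m := m) hodd
  have := Fact.mk hp
  have hc : ∀ i, z i ∈ Subgroup.center G := fun i => by
    by_cases hi : i = 0
    · exact hi ▸ h0
    · exact ((mem_commutator_iff hodd _).mp (hz i hi)).1
  have hpow : ∀ (i) (k : ℕ), z i ^ k = 1 → (x i * z i) ^ k = x i ^ k := fun i k hk => by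
    rw [(show Commute (x i) (z i) from Subgroup.mem_center_iff.mp (hc i) _).mul_pow, hk, mul_one]
  have h2 : ∀ i, i ≠ 0 → z i ^ p ^ 2 = 1 := fun i hi => pow_sq_eq_one hodd (hz i hi)
  have h4 : ∀ i, i ≠ 0 → z i ^ p ^ 4 = 1 := fun i hi => by
    rw [pow_add p 2 2, pow_mul, h2 i hi, one_pow]
  have h02 : z 0 ^ p ^ (m + 2) = 1 := pow_eq_one_of_mem_center hodd h0
  have h04 : z 0 ^ p ^ (m + 4) = 1 := by rw [pow_add p (m + 2) 2, pow_mul, h02, one_pow]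
  have hR : JRYRel p (m + 4) (fun i => x i * z i) := by
    constructor
    · rw [hpow 0 _ h04, R.pow0]
    · rw [hpow 1 _ (h4 1 (by decide)), R.pow1]
    · rw [hpow 2 _ (h4 2 (by decide)), R.pow2]
    · rw [hpow 3 _ (h2 3 (by decide)), R.pow3]
    · rw [commutatorElement_mul_center (hc _) (hc _), hpow 1 _ (h2 1 (by decide)), R.comm01]
    · rw [commutatorElement_mul_center (hc _) (hc _), hpow 1 _ (h2 1 (by decide)), R.comm02]
    · rw [commutatorElement_mul_center (hc _) (hc _), hpow 2 _ (h2 2 (by decide)), R.comm03]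
    -- The right-hand side is a power of the first generator, whose displacement is only central;
    -- the exponent `p^(m+2)` kills the whole centre.
    · rw [commutatorElement_mul_center (hc _) (hc _), R.comm12]; exact (hpow 0 _ h02).symm
    · rw [commutatorElement_mul_center (hc _) (hc _), hpow 2 _ (h2 2 (by decide)), R.comm13]
    · rw [commutatorElement_mul_center (hc _) (hc _), hpow 1 _ (h2 1 (by decide)), R.comm23]
  let f : G →* G := PresentedGroup.toGroup ((jryRel_iff _).mp hR)
  have hf : ∀ i, f (x i) = x i * z i := fun i => PresentedGroup.toGroup.of _
  -- The range together with the Frattini subgroup contains the generators, since the displacements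
  -- are central and `Z ≤ Φ`.
  have hsurj : Function.Surjective f := by
    rw [← MonoidHom.range_eq_top]
    apply frattini_nongenerating
    rw [eq_top_iff, ← closure_x, Subgroup.closure_le]
    rintro _ ⟨i, rfl⟩
    have : x i = f (x i) * (z i)⁻¹ := by rw [hf, mul_inv_cancel_right]
    rw [this]
    exact mul_mem (le_sup_left (a := f.range) (MonoidHom.mem_range.mpr ⟨_, rfl⟩))
      (le_sup_right (a := f.range) (center_le_frattini hp hodd (inv_mem (hc i))))
  exact ⟨MulEquiv.ofBijective f ⟨Finite.injective_iff_surjective.mpr hsurj, hsurj⟩, hf⟩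

end JRYGroup

/-! ### Orders, exponent, rank, class and strict inclusions. -/

namespace JRYGroup

open JRYModel

variable {p m : ℕ}

local notation "G" => JRYGroup p (m + 4)

theorem commutator_le_center (hodd : Odd p) : commutator G ≤ Subgroup.center G :=
  fun g hg => ((mem_commutator_iff hodd g).mp hg).1

theorem card_center (hodd : Odd p) : Nat.card (Subgroup.center G) = p ^ (m + 6) := by
  let e : Subgroup.center G ≃ {a : ZMod (p ^ (m + 2 + 2)) // red p (m + 2) a = 0} ×
      {b : ZMod (p ^ (2 + 2)) // red p 2 b = 0} × {c : ZMod (p ^ (2 + 2)) // red p 2 c = 0} :=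
    { toFun := fun g =>
        have h := (forall_redHom_iff _).mp ((mem_center_iff hodd g.1).mp g.2)
        (⟨_, h.1⟩, ⟨_, h.2.1⟩, ⟨_, h.2.2.1⟩)
      invFun := fun v => ⟨(equivModel hodd).symm ⟨v.1.1, v.2.1.1, v.2.2.1, 0⟩, by
        rw [mem_center_iff hodd, forall_redHom_iff]
        have : toModel (m := m) hodd ((equivModel hodd).symm ⟨v.1.1, v.2.1.1, v.2.2.1, 0⟩) =
          ⟨v.1.1, v.2.1.1, v.2.2.1, 0⟩ := (equivModel hodd).apply_symm_apply _
        rw [this]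
        exact ⟨v.1.2, v.2.1.2, v.2.2.2, rfl⟩⟩
      left_inv := fun g => by
        have h := (forall_redHom_iff _).mp ((mem_center_iff hodd g.1).mp g.2)
        refine Subtype.ext ((equivModel hodd).symm_apply_eq.mpr ?_)
        exact JRYModel.ext rfl rfl rfl h.2.2.2.symm
      right_inv := fun v => by
        have : toModel (m := m) hodd ((equivModel hodd).symm ⟨v.1.1, v.2.1.1, v.2.2.1, 0⟩) =
          ⟨v.1.1, v.2.1.1, v.2.2.1, 0⟩ := (equivModel hodd).apply_symm_apply _
        refine Prod.ext (Subtype.ext ?_) (Prod.ext (Subtype.ext ?_) (Subtype.ext ?_))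
        · exact congrArg JRYModel.c0 this
        · exact congrArg JRYModel.c1 this
        · exact congrArg JRYModel.c2 this }
  rw [Nat.card_congr e, Nat.card_prod, Nat.card_prod, card_red_ker hodd.pos, card_red_ker hodd.pos]
  ring

theorem card_commutator (hodd : Odd p) : Nat.card (commutator G) = p ^ 6 := by
  have key (a b c : ZMod (p ^ 2)) : toModel (m := m) hodd ((equivModel hodd).symm
      ⟨scale p (m + 2) a, scale p 2 b, scale p 2 c, 0⟩) =
      ⟨scale p (m + 2) a, scale p 2 b, scale p 2 c, 0⟩ := (equivModel hodd).apply_symm_apply _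
  let f : ZMod (p ^ 2) × ZMod (p ^ 2) × ZMod (p ^ 2) → commutator G := fun v =>
    ⟨(equivModel hodd).symm ⟨scale p (m + 2) v.1, scale p 2 v.2.1, scale p 2 v.2.2, 0⟩, by
      rw [mem_commutator_iff hodd, mem_center_iff hodd, forall_redHom_iff, sqHom_eq_one_iff, key]
      exact ⟨⟨red_scale (by omega) _, red_scale le_rfl _, red_scale le_rfl _, rfl⟩, sq_mul_scale _⟩⟩
  have hf : Function.Bijective f := by
    constructor
    · rintro ⟨a, b, c⟩ ⟨a', b', c'⟩ h
      have h' := congrArg (fun g => toModel (m := m) hodd g.1) h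
      simp only [f, key, JRYModel.mk.injEq, (scale_injective hodd.pos).eq_iff] at h'
      simp [h']
    · rintro ⟨g, hg⟩
      obtain ⟨hc, hs⟩ := (mem_commutator_iff hodd g).mp hg
      rw [mem_center_iff hodd, forall_redHom_iff] at hc
      rw [sqHom_eq_one_iff] at hs
      -- In `ZMod (p ^ 4)` the multiples of `p^2` are exactly the elements killed by `p^2`, so the
      -- last coordinates impose no condition beyond centrality.
      have lift2 : ∀ y : ZMod (p ^ (2 + 2)), red p 2 y = 0 → ∃ w, scale p 2 w = y := fun y hy => by
        rw [← sq_mul_eq_zero_iff hodd.pos, ← scale_red, hy, map_zero]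
      obtain ⟨a, ha⟩ := (sq_mul_eq_zero_iff hodd.pos _).mp hs
      obtain ⟨b, hb⟩ := lift2 _ hc.2.1
      obtain ⟨c, hc'⟩ := lift2 _ hc.2.2.1
      refine ⟨(a, b, c), Subtype.ext ((equivModel hodd).symm_apply_eq.mpr ?_)⟩
      exact JRYModel.ext ha hb hc' hc.2.2.2.symm
  rw [← Nat.card_congr (Equiv.ofBijective f hf)]
  simp only [Nat.card_prod, Nat.card_zmod]
  ring

theorem card_aut (hp : p.Prime) (hodd : Odd p) : Nat.card (MulAut G) = p ^ (m + 4 + 20) := by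
  let F : MulAut G → Subgroup.center G × commutator G × commutator G × commutator G := fun α =>
    (⟨_, aut_central hodd α (x 0)⟩,
      ⟨_, aut_displacement_mem_commutator hodd α (i := 1) (by decide)⟩,
      ⟨_, aut_displacement_mem_commutator hodd α (i := 2) (by decide)⟩,
      ⟨_, aut_displacement_mem_commutator hodd α (i := 3) (by decide)⟩)
  have hF : Function.Bijective F := by
    constructor
    · intro α β h
      simp only [F, Prod.mk.injEq, Subtype.mk.injEq, mul_right_inj] at h
      refine MulEquiv.toMonoidHom_injective (PresentedGroup.ext fun i => ?_)
      fin_cases i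
      exacts [h.1, h.2.1, h.2.2.1, h.2.2.2]
    · rintro ⟨⟨z0, h0⟩, ⟨z1, h1⟩, ⟨z2, h2⟩, ⟨z3, h3⟩⟩
      obtain ⟨α, hα⟩ := exists_aut hp hodd ![z0, z1, z2, z3] h0 (fun i hi => by
        fin_cases i
        exacts [absurd rfl hi, h1, h2, h3])
      exact ⟨α, by simp [F, hα]⟩
  rw [Nat.card_congr (Equiv.ofBijective F hF)]
  simp only [Nat.card_prod, card_center hodd, card_commutator hodd]
  ring

theorem exponent_eq (hodd : Odd p) : Monoid.exponent G = p ^ (m + 4) := by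
  refine Nat.dvd_antisymm (Monoid.exponent_dvd_of_forall_pow_eq_one fun g => ?_) ?_
  · have h4 : 2 ≤ m + 4 := by omega
    have z0 : (p : ZMod (p ^ (m + 2 + 2))) ^ (m + 4) = 0 := by
      exact_mod_cast ZMod.natCast_self (p ^ (m + 2 + 2))
    have z1 : (p : ZMod (p ^ (2 + 2))) ^ (m + 4) = 0 := by
      have : (p : ZMod (p ^ (2 + 2))) ^ 4 = 0 := by exact_mod_cast ZMod.natCast_self (p ^ (2 + 2))
      rw [pow_add (p : ZMod (p ^ (2 + 2))), this, mul_zero]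
    apply (toModel_bijective hodd).1
    rw [map_pow, map_one]
    ext
    · rw [JRYModel.pow_c0 hodd _ h4, z0]; simp
    · rw [JRYModel.pow_c1 hodd _ h4, z1]; simp
    · rw [JRYModel.pow_c2 hodd _ h4, z1]; simp
    · rw [pow_c3_eq_zero _ h4]; simp
  · have h := congrArg (fun g => (toModel (m := m) hodd g).c0)
      (Monoid.pow_exponent_eq_one (x 0 : G))
    simp only [map_pow, map_one, toModel_x] at h
    rw [← zpow_natCast, gen_zpow0, Int.cast_natCast] at h
    exact (ZMod.natCast_eq_zero_iff _ _).mp h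

/-- The reduction of the four coordinates modulo `p`. -/
def toVector (hodd : Odd p) : G →* Multiplicative (Fin 4 → ZMod p) where
  toFun g := Multiplicative.ofAdd fun j =>
    ZMod.castHom (dvd_pow_self p two_ne_zero) (ZMod p) (redHom j (toModel hodd g)).toAdd
  map_one' := by
    rw [← ofAdd_zero]; congr 1; funext j; simp
  map_mul' a b := by
    rw [← ofAdd_add]; congr 1; funext j; simp

theorem toVector_surjective (hodd : Odd p) : Function.Surjective (toVector (m := m) hodd) := by
  intro v
  have lift : ∀ y : ZMod p, ∃ w : ZMod (p ^ 2),
      ZMod.castHom (dvd_pow_self p two_ne_zero) (ZMod p) w = y := ZMod.ringHom_surjective _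
  choose w hw using fun j => lift (v.toAdd j)
  obtain ⟨a, ha⟩ := red_surjective (k := m + 2) (w 0)
  obtain ⟨b, hb⟩ := red_surjective (k := 2) (w 1)
  obtain ⟨c, hc⟩ := red_surjective (k := 2) (w 2)
  obtain ⟨g, hg⟩ := (toModel_bijective hodd).2 (⟨a, b, c, w 3⟩ : JRYModel p m)
  refine ⟨g, congrArg Multiplicative.ofAdd (funext fun j => ?_)⟩
  refine Eq.trans ?_ (hw j)
  rw [hg]
  fin_cases j
  exacts [congrArg _ ha, congrArg _ hb, congrArg _ hc, rfl]

/-- The linear span of `S` is in particular a subgroup, so a generating set spans a space of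
dimension `4`. -/
theorem four_le_card_of_closure_eq_top {p : ℕ} [Fact p.Prime]
    (S : Finset (Multiplicative (Fin 4 → ZMod p))) (hS : Subgroup.closure (S : Set (Multiplicative (Fin 4 → ZMod p))) = ⊤) :
    4 ≤ S.card := by
  let T : Finset (Fin 4 → ZMod p) := S.map Multiplicative.toAdd.toEmbedding
  have hspan : Submodule.span (ZMod p) (T : Set (Fin 4 → ZMod p)) = ⊤ := by
    rw [eq_top_iff]
    intro v _
    have hle : Subgroup.closure (S : Set (Multiplicative (Fin 4 → ZMod p))) ≤
        AddSubgroup.toSubgroup (Submodule.span (ZMod p) (T : Set (Fin 4 → ZMod p))).toAddSubgroup := by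
      rw [Subgroup.closure_le]
      intro s hs
      have hsT : s.toAdd ∈ (T : Set (Fin 4 → ZMod p)) :=
        Finset.mem_map_of_mem Multiplicative.toAdd.toEmbedding hs
      have hsp : s.toAdd ∈ Submodule.span (ZMod p) (T : Set (Fin 4 → ZMod p)) :=
        Submodule.subset_span hsT
      exact hsp
    rw [hS] at hle
    exact hle (Subgroup.mem_top (Multiplicative.ofAdd v))
  have h := finrank_span_finset_le_card (R := ZMod p) T
  rw [Set.finrank, hspan, finrank_top, Module.finrank_fin_fun, Finset.card_map] at h
  exact h

theorem rank_eq (hp : p.Prime) (hodd : Odd p) : ∃ _ : Group.FG G, Group.rank G = 4 := by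
  classical
  have := finite (m := m) hodd
  have := Fact.mk hp
  refine ⟨inferInstance, le_antisymm ?_ ?_⟩
  · refine (Group.rank_le (S := Finset.univ.image x) ?_).trans ?_
    · rw [Finset.coe_image, Finset.coe_univ, Set.image_univ, closure_x]
    · exact Finset.card_image_le.trans (by simp)
  · obtain ⟨S, hS, hcl⟩ := Group.rank_spec G
    rw [← hS]
    refine (four_le_card_of_closure_eq_top (p := p) (S.image (toVector hodd)) ?_).trans
      Finset.card_image_le
    rw [Finset.coe_image, ← MonoidHom.map_closure, hcl]
    exact Subgroup.map_top_of_surjective _ (toVector_surjective hodd)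

/-- One witness for two facts: `G` is not abelian, and, `p`-th powers being in the Frattini
subgroup, `Z ≠ Φ`. -/
theorem x_pow_notMem_center (hp : p.Prime) (hodd : Odd p) :
    (x 1 : G) ^ p ∉ Subgroup.center G := by
  rw [mem_center_iff hodd, forall_redHom_iff]
  rintro ⟨-, h, -⟩
  rw [map_pow, toModel_x, pow_r1] at h
  have : ((p : ℕ) : ZMod (p ^ 2)) = 0 := by simpa [gen, r1] using h
  rw [ZMod.natCast_eq_zero_iff] at this
  have := (Nat.pow_dvd_pow_iff_le_right hp.one_lt).mp (this.trans (pow_one p).symm.dvd)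
  omega

theorem nilpotencyClass_eq (hp : p.Prime) (hodd : Odd p) :
    Group.IsNilpotent G ∧ Group.nilpotencyClass G = 2 := by
  have := finite (m := m) hodd
  have := Fact.mk hp
  have hn : Group.IsNilpotent G := (isPGroup hodd).isNilpotent
  refine ⟨hn, le_antisymm ?_ ?_⟩
  · rw [← Subgroup.lowerCentralSeries_eq_bot_iff_nilpotencyClass_le]
    refine Subgroup.lowerCentralSeries_succ_eq_bot ⊤ ?_
    rw [Subgroup.top_lowerCentralSeries_one]
    exact commutator_le_center hodd
  · by_contra h
    have h1 : Group.nilpotencyClass G ≤ 1 := by omega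
    rw [Group.IsNilpotent.nilpotencyClass_le_one_iff] at h1
    exact x_pow_notMem_center (m := m) hp hodd
      (Subgroup.mem_center_iff.mpr fun g => h1.is_comm.comm g _)

theorem center_lt_frattini (hp : p.Prime) (hodd : Odd p) : Subgroup.center G < frattini G := by
  have := finite (m := m) hodd
  have := Fact.mk hp
  exact lt_of_le_of_ne (center_le_frattini hp hodd) fun h =>
    x_pow_notMem_center (m := m) hp hodd (h ▸ (isPGroup hodd).pow_mem_frattini _)

theorem commutator_lt_center (hp : p.Prime) (hodd : Odd p) (hm : 1 ≤ m) :
    commutator G < Subgroup.center G := by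
  refine lt_of_le_of_ne (commutator_le_center hodd) fun h => ?_
  have hcard := card_center (m := m) hodd
  rw [← h, card_commutator hodd] at hcard
  have := Nat.pow_right_injective hp.two_le hcard
  omega

theorem commutator_eq_center (hodd : Odd p) :
    commutator (JRYGroup p 4) = Subgroup.center (JRYGroup p 4) := by
  have := finite (m := 0) hodd
  refine Subgroup.eq_of_le_of_card_ge (commutator_le_center (m := 0) hodd) ?_
  rw [card_center (m := 0) hodd, card_commutator (m := 0) hodd]

end JRYGroup

theorem theoremA (p n : ℕ) (hp : p.Prime) (hodd : Odd p) (hn : 4 ≤ n) :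
    -- order and exponent of `G`
    Nat.card (JRYGroup p n) = p ^ (n + 10) ∧
    Monoid.exponent (JRYGroup p n) = p ^ n ∧
    -- the minimal number of generators of `G` is `4`
    (∃ _ : Group.FG (JRYGroup p n), Group.rank (JRYGroup p n) = 4) ∧
    -- `G` is nilpotent of class exactly `2`
    (Group.IsNilpotent (JRYGroup p n) ∧ Group.nilpotencyClass (JRYGroup p n) = 2) ∧
    -- position of the commutator subgroup, the centre and the Frattini subgroup
    (n = 4 →
      commutator (JRYGroup p n) = Subgroup.center (JRYGroup p n) ∧
      Subgroup.center (JRYGroup p n) < frattini (JRYGroup p n)) ∧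
    (5 ≤ n →
      commutator (JRYGroup p n) < Subgroup.center (JRYGroup p n) ∧
      Subgroup.center (JRYGroup p n) < frattini (JRYGroup p n)) ∧
    -- every automorphism of `G` is central
    (∀ (α : MulAut (JRYGroup p n)) (g : JRYGroup p n),
      g⁻¹ * α g ∈ Subgroup.center (JRYGroup p n)) ∧
    -- `Aut(G)` is abelian of order `p ^ (n + 20)`
    (∀ α β : MulAut (JRYGroup p n), α * β = β * α) ∧
    Nat.card (MulAut (JRYGroup p n)) = p ^ (n + 20) := by
  obtain ⟨m, rfl⟩ := Nat.exists_eq_add_of_le' hn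
  refine ⟨JRYGroup.card_eq hodd, JRYGroup.exponent_eq hodd, JRYGroup.rank_eq hp hodd,
    JRYGroup.nilpotencyClass_eq hp hodd, fun h => ?_,
    fun h => ⟨JRYGroup.commutator_lt_center hp hodd (by omega), JRYGroup.center_lt_frattini hp hodd⟩,
    JRYGroup.aut_central hodd, JRYGroup.aut_comm hodd, JRYGroup.card_aut hp hodd⟩
  obtain rfl : m = 0 := by omega
  exact ⟨JRYGroup.commutator_eq_center hodd, JRYGroup.center_lt_frattini hp hodd⟩
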